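/- Let $(M,\langle\cdot,\cdot\rangle)$ be an $m$-dimensional smooth Lorentzian manifold with Levi-Civita connection $\nabla$, and let $\mathcal K_t,\mathcal K_\varphi$ be two commuting smooth Killing vector fields on $M$ with $\det(\langle\mathcal K_\alpha,\mathcal K_\beta\rangle)_{\alpha,\beta\in\{t,\varphi\}}<0$ everywhere. Fix $\rho\in\mathbb R$, put $\hat\rho=\rho\,\mathcal K_t+\mathcal K_\varphi$, and let $\mathcal O=\{x\in M:\langle\hat\rho,\hat\rho\rangle>0\}$ be the accessible region. Let $S$ be an $n$-dimensional Lorentzian manifold (without boundary) with Levi-Civita connection $\mathcal D$, isometrically embedded in $M$, such that $S\subset\mathcal O$ and $S$ is invariant, i.e. the vector fields $\mathcal K_\alpha$ and $[\mathcal K_\alpha,\mathcal K_\beta]$ are tangent to $S$. Let $\mathrm{II}(X,Y)=\nabla_YX-\mathcal D_YX$ ($X,Y\in TS$) be the second fundamental form of $S$, and let $\hat\rho^{\perp}\subset TS$ be the subbundle of the vectors tangent to $S$ that are orthogonal to $\hat\rho$. Say that a curve $\gamma$ has impact parameter $\rho$ if $\langle\mathcal K_t,\dot\gamma\rangle\neq0$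 and $\rho=-\langle\mathcal K_\varphi,\dot\gamma\rangle/\langle\mathcal K_t,\dot\gamma\rangle$ along $\gamma$. Then the following are equivalent: (i) every (affinely parametrized) null geodesic $\gamma$ of $S$, defined on an open interval, with impact parameter $\rho$ is a null geodesic of $M$; (ii) $S$ is totally $\hat\rho^{\perp}$ umbilic: at every point of $S$ there is a vector $\mathrm H$ normal to $S$ such that $\mathrm{II}(X,Y)=\mathrm H\,\langle X,Y\rangle$ for all $X,Y\in\hat\rho^{\perp}$. -/

import Mathlib

open scoped Manifold ContDiff
open Bundle VectorField

noncomputable section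

/-- Christoffel symbols (of the second kind) of a field `G` of symmetric nondegenerate bilinear
forms on an open part of a finite-dimensional real vector space:
`Γ_u(v, w)` is the vector `z` such that, for all `y`,
`G_u(z, y) = (1/2) * (∂_v G(w, y) + ∂_w G(v, y) - ∂_y G(v, w))`. -/
def christoffel {E : Type*} [NormedAddCommGroup E] [NormedSpace ℝ E]
    (G : E → (E →L[ℝ] E →L[ℝ] ℝ)) (u v w : E) : E :=
  (G u).inverse ((1 / 2 : ℝ) •
    (fderiv ℝ G u v w + fderiv ℝ G u w v - ((fderiv ℝ G u).flip v).flip w))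

/-- A bilinear form has Lorentzian signature `(-, +, ..., +)`: it is negative on some vector
and positive definite on the orthogonal complement of that vector. -/
def IsLorentzianForm {T : Type*} [AddCommGroup T] [Module ℝ T] (b : T → T → ℝ) : Prop :=
  ∃ u : T, b u u < 0 ∧ ∀ w : T, b u w = 0 → w ≠ 0 → 0 < b w w

/-- A smooth Lorentzian metric on an `m`-dimensional manifold. -/
structure LorentzianMetric (m : ℕ) (M : Type*) [TopologicalSpace M]
    [ChartedSpace (EuclideanSpace ℝ (Fin m)) M] [IsManifold (𝓡 m) ∞ M] where
  /-- The scalar product on each tangent space. -/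
  val : ∀ x : M, TangentSpace (𝓡 m) x →L[ℝ] TangentSpace (𝓡 m) x →L[ℝ] ℝ
  symm : ∀ (x : M) (v w : TangentSpace (𝓡 m) x), val x v w = val x w v
  lorentzian : ∀ x : M, IsLorentzianForm fun v w : TangentSpace (𝓡 m) x => val x v w
  smooth : ContMDiff (𝓡 m)
    ((𝓡 m).prod 𝓘(ℝ, EuclideanSpace ℝ (Fin m) →L[ℝ] EuclideanSpace ℝ (Fin m) →L[ℝ] ℝ)) ∞
    (fun x => TotalSpace.mk'
      (EuclideanSpace ℝ (Fin m) →L[ℝ] EuclideanSpace ℝ (Fin m) →L[ℝ] ℝ) x (val x))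

/-- Components of tangent vectors at `x` in the preferred chart at `q`. -/
def toCoord {m : ℕ} {M : Type*} [TopologicalSpace M] [ChartedSpace (EuclideanSpace ℝ (Fin m)) M]
    (q x : M) : TangentSpace (𝓡 m) x →L[ℝ] EuclideanSpace ℝ (Fin m) :=
  mfderiv (𝓡 m) 𝓘(ℝ, EuclideanSpace ℝ (Fin m)) (extChartAt (𝓡 m) q) x

/-- The tangent vector with given components in the preferred chart at `q`, at the point with
coordinates `u`. -/
def ofCoord {m : ℕ} {M : Type*} [TopologicalSpace M] [ChartedSpace (EuclideanSpace ℝ (Fin m)) M]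
    (q : M) (u : EuclideanSpace ℝ (Fin m)) :
    EuclideanSpace ℝ (Fin m) →L[ℝ] TangentSpace (𝓡 m) ((extChartAt (𝓡 m) q).symm u) :=
  mfderiv 𝓘(ℝ, EuclideanSpace ℝ (Fin m)) (𝓡 m) (extChartAt (𝓡 m) q).symm u

namespace LorentzianMetric

variable {m : ℕ} {M : Type*} [TopologicalSpace M]
  [ChartedSpace (EuclideanSpace ℝ (Fin m)) M] [IsManifold (𝓡 m) ∞ M]

/-- The metric written in the preferred chart at `q`. -/
def inChart (g : LorentzianMetric m M) (q : M) (u : EuclideanSpace ℝ (Fin m)) :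
    EuclideanSpace ℝ (Fin m) →L[ℝ] EuclideanSpace ℝ (Fin m) →L[ℝ] ℝ :=
  letI A : EuclideanSpace ℝ (Fin m) →L[ℝ] EuclideanSpace ℝ (Fin m) := ofCoord q u
  letI B : EuclideanSpace ℝ (Fin m) →L[ℝ] EuclideanSpace ℝ (Fin m) →L[ℝ] ℝ :=
    g.val ((extChartAt (𝓡 m) q).symm u)
  B.bilinearComp A A

theorem inChart_apply (g : LorentzianMetric m M) (q : M) (u v w : EuclideanSpace ℝ (Fin m)) :
    g.inChart q u v w =
      g.val ((extChartAt (𝓡 m) q).symm u) (ofCoord q u v) (ofCoord q u w) := rfl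

/-- The Levi-Civita covariant derivative `∇_v W` at `p` of a vector field `W` along a map
`c : N → M`, in the direction `v ∈ T_p N`. In the coordinates of the preferred chart at `c p` it is
`∂_v W + Γ(dc v, W)`; the tangent space at `c p` is the model space via that same chart.
`N = M` and `c = id` gives the Levi-Civita connection of `M`; `N = ℝ` and `c` a curve gives the
covariant derivative along the curve. -/
def covDerivAlong (g : LorentzianMetric m M) {F H : Type*} [NormedAddCommGroup F] [NormedSpace ℝ F]
    [TopologicalSpace H] (J : ModelWithCorners ℝ F H) {N : Type*} [TopologicalSpace N]
    [ChartedSpace H N] (c : N → M) (W : ∀ x : N, TangentSpace (𝓡 m) (c x)) (p : N)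
    (v : TangentSpace J p) : TangentSpace (𝓡 m) (c p) :=
  letI localW : N → EuclideanSpace ℝ (Fin m) := fun x => toCoord (c p) (c x) (W x)
  letI dW : EuclideanSpace ℝ (Fin m) :=
    mfderiv J 𝓘(ℝ, EuclideanSpace ℝ (Fin m)) localW p v
  (dW + christoffel (g.inChart (c p)) (extChartAt (𝓡 m) (c p) (c p))
    (mfderiv J (𝓡 m) c p v) (W p) : EuclideanSpace ℝ (Fin m))

/-- The Levi-Civita connection: `g.leviCivita Y x v` is `(∇_v Y)(x)`. -/
def leviCivita (g : LorentzianMetric m M) (Y : ∀ x : M, TangentSpace (𝓡 m) x) (x : M)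
    (v : TangentSpace (𝓡 m) x) : TangentSpace (𝓡 m) x :=
  g.covDerivAlong (𝓡 m) (fun y : M => y) Y x v

/-- A smooth Killing vector field: `⟨∇_v K, w⟩ + ⟨v, ∇_w K⟩ = 0`. -/
structure IsKilling (g : LorentzianMetric m M) (K : ∀ x : M, TangentSpace (𝓡 m) x) : Prop where
  smooth : ContMDiff (𝓡 m) (𝓡 m).tangent ∞ fun x => (⟨x, K x⟩ : TangentBundle (𝓡 m) M)
  killing : ∀ (x : M) (v w : TangentSpace (𝓡 m) x),
    g.val x (g.leviCivita K x v) w + g.val x v (g.leviCivita K x w) = 0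

end LorentzianMetric

/-- The velocity of a curve in a manifold. -/
def velocity (m : ℕ) {M : Type*} [TopologicalSpace M] [ChartedSpace (EuclideanSpace ℝ (Fin m)) M]
    (γ : ℝ → M) (t : ℝ) : TangentSpace (𝓡 m) (γ t) :=
  mfderiv 𝓘(ℝ, ℝ) (𝓡 m) γ t (1 : ℝ)

namespace LorentzianMetric

variable {m n : ℕ} {M : Type*} [TopologicalSpace M]
  [ChartedSpace (EuclideanSpace ℝ (Fin m)) M] [IsManifold (𝓡 m) ∞ M]
  {S : Type*} [TopologicalSpace S]
  [ChartedSpace (EuclideanSpace ℝ (Fin n)) S] [IsManifold (𝓡 n) ∞ S]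

/-- `γ` is an affinely parametrized null geodesic on the open interval `J`: a twice continuously
differentiable (hence smooth) solution of `∇_γ' γ' = 0` with `γ' ≠ 0` and `⟨γ', γ'⟩ = 0`. -/
structure IsNullGeodesicOn (g : LorentzianMetric m M) (γ : ℝ → M) (J : Set ℝ) : Prop where
  isOpen : IsOpen J
  ordConnected : J.OrdConnected
  contMDiffOn : ContMDiffOn 𝓘(ℝ, ℝ) (𝓡 m) 2 γ J
  geodesic : ∀ t ∈ J, g.covDerivAlong 𝓘(ℝ, ℝ) γ (velocity m γ) t (1 : ℝ) = 0
  velocity_ne_zero : ∀ t ∈ J, velocity m γ t ≠ 0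
  null : ∀ t ∈ J, g.val (γ t) (velocity m γ t) (velocity m γ t) = 0

/-- The Gram matrix `𝒢_{αβ} = ⟨K_α, K_β⟩` at `x`. -/
def gram (g : LorentzianMetric m M) (K : Fin 2 → ∀ x : M, TangentSpace (𝓡 m) x) (x : M) :
    Matrix (Fin 2) (Fin 2) ℝ :=
  Matrix.of fun α β => g.val x (K α x) (K β x)

/-- Two commuting Killing vector fields, `K 0 = K_t` and `K 1 = K_φ`, with `det 𝒢 < 0`. -/
structure IsKillingPair (g : LorentzianMetric m M)
    (K : Fin 2 → ∀ x : M, TangentSpace (𝓡 m) x) : Prop where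
  killing : ∀ α, g.IsKilling (K α)
  commute : ∀ x, mlieBracket (𝓡 m) (K 0) (K 1) x = 0
  det_neg : ∀ x, (g.gram K x).det < 0

/-- The curve `γ` has, on `J`, nonzero energy `-⟨K_t, γ'⟩` and impact parameter
`ρ = -⟨K_φ, γ'⟩ / ⟨K_t, γ'⟩`. -/
def HasImpactParameterOn (g : LorentzianMetric m M)
    (K : Fin 2 → ∀ x : M, TangentSpace (𝓡 m) x) (ρ : ℝ) (γ : ℝ → M) (J : Set ℝ) : Prop :=
  ∀ t ∈ J, g.val (γ t) (K 0 (γ t)) (velocity m γ t) ≠ 0 ∧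
    ρ = -g.val (γ t) (K 1 (γ t)) (velocity m γ t) / g.val (γ t) (K 0 (γ t)) (velocity m γ t)

end LorentzianMetric

/-- The Killing vector field `ρ̂ = ρ K_t + K_φ`. -/
def rhoHat {m : ℕ} {M : Type*} [TopologicalSpace M] [ChartedSpace (EuclideanSpace ℝ (Fin m)) M]
    (K : Fin 2 → ∀ x : M, TangentSpace (𝓡 m) x) (ρ : ℝ) (x : M) : TangentSpace (𝓡 m) x :=
  ρ • K 0 x + K 1 x

namespace LorentzianMetric

variable {m n : ℕ} {M : Type*} [TopologicalSpace M]
  [ChartedSpace (EuclideanSpace ℝ (Fin m)) M] [IsManifold (𝓡 m) ∞ M]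
  {S : Type*} [TopologicalSpace S]
  [ChartedSpace (EuclideanSpace ℝ (Fin n)) S] [IsManifold (𝓡 n) ∞ S]

/-- The accessible region `𝒪 = {x | ⟨ρ̂, ρ̂⟩ > 0}`. -/
def accessibleRegion (g : LorentzianMetric m M) (K : Fin 2 → ∀ x : M, TangentSpace (𝓡 m) x)
    (ρ : ℝ) : Set M :=
  {x | 0 < g.val x (rhoHat K ρ x) (rhoHat K ρ x)}

/-- `f` exhibits `(S, h)` as a Lorentzian submanifold of `(M, g)`: it is a smooth isometric
embedding. -/
structure IsIsometricEmbedding (h : LorentzianMetric n S) (g : LorentzianMetric m M)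
    (f : S → M) : Prop where
  isSmoothEmbedding : Manifold.IsSmoothEmbedding (𝓡 n) (𝓡 m) ∞ f
  isometric : ∀ (p : S) (v w : TangentSpace (𝓡 n) p),
    h.val p v w = g.val (f p) (mfderiv (𝓡 n) (𝓡 m) f p v) (mfderiv (𝓡 n) (𝓡 m) f p w)

/-- The second fundamental form of the isometric embedding `f : (S, h) → (M, g)` at `p`, defined by
the Gauss decomposition `II(X, Y) = ∇_Y X - 𝒟_Y X`, where `∇` and `𝒟` are the Levi-Civita
connections of `M` and `S`. Here `X` is the vector field with `X(p) = v` and constant components in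
the preferred chart of `S` at `p`, and `Y(p) = w`. -/
def secondFundamentalForm (g : LorentzianMetric m M) (h : LorentzianMetric n S) (f : S → M)
    (p : S) (v w : TangentSpace (𝓡 n) p) : TangentSpace (𝓡 m) (f p) :=
  letI X : ∀ x : S, TangentSpace (𝓡 n) x :=
    mpullback (𝓡 n) 𝓘(ℝ, EuclideanSpace ℝ (Fin n)) (extChartAt (𝓡 n) p) fun _ => v
  g.covDerivAlong (𝓡 n) f (fun x => mfderiv (𝓡 n) (𝓡 m) f x (X x)) p w
    - mfderiv (𝓡 n) (𝓡 m) f p (h.leviCivita X p w)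

/-- For a subbundle `V ⊆ TS`, the submanifold is totally `V` umbilic: at every point there is a
vector `H`, normal to `S`, with `II(X, Y) = ⟨X, Y⟩ H` for all `X, Y ∈ V`. -/
def IsTotallyUmbilic (g : LorentzianMetric m M) (h : LorentzianMetric n S) (f : S → M)
    (V : ∀ p : S, Submodule ℝ (TangentSpace (𝓡 n) p)) : Prop :=
  ∀ p : S, ∃ H : TangentSpace (𝓡 m) (f p),
    (∀ z : TangentSpace (𝓡 n) p, g.val (f p) H (mfderiv (𝓡 n) (𝓡 m) f p z) = 0) ∧
    ∀ v ∈ V p, ∀ w ∈ V p, secondFundamentalForm g h f p v w = h.val p v w • H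

/-- The orthogonal complement `ρ̂^⊥ ⊆ TS`: tangent vectors of `S` orthogonal to `ρ̂`. -/
def rhoPerp (g : LorentzianMetric m M) (K : Fin 2 → ∀ x : M, TangentSpace (𝓡 m) x) (ρ : ℝ)
    (f : S → M) (p : S) : Submodule ℝ (TangentSpace (𝓡 n) p) :=
  LinearMap.ker ((g.val (f p) (rhoHat K ρ (f p))).comp (mfderiv (𝓡 n) (𝓡 m) f p)).toLinearMap

end LorentzianMetric

/-- The submanifold `f : S → M` is invariant: the fields `K_α` and `[K_α, K_β]` are tangent
to it. -/
def IsInvariantSubmanifold {m n : ℕ} {M S : Type*} [TopologicalSpace M]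
    [ChartedSpace (EuclideanSpace ℝ (Fin m)) M] [TopologicalSpace S]
    [ChartedSpace (EuclideanSpace ℝ (Fin n)) S]
    (K : Fin 2 → ∀ x : M, TangentSpace (𝓡 m) x) (f : S → M) : Prop :=
  ∀ p : S, (∀ α, K α (f p) ∈ Set.range (mfderiv (𝓡 n) (𝓡 m) f p)) ∧
    ∀ α β, mlieBracket (𝓡 m) (K α) (K β) (f p) ∈ Set.range (mfderiv (𝓡 n) (𝓡 m) f p)

end

/-!
The Gauss formula along a curve (`LorentzianMetric.covDerivAlong_comp_velocity`) says that the
acceleration in `M` of a curve `γ` of `S` is its acceleration in `S` plus `II(γ', γ')`. Having impact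
parameter `ρ` forces `γ'` to be orthogonal to `ρ̂`, so that a null geodesic of `S` with impact
parameter `ρ` is a geodesic of `M` if and only if `II` vanishes on its null velocity. If `S` is
`ρ̂^⊥` umbilic this is immediate.

Conversely, let `v ≠ 0` be a null vector tangent to `S` and orthogonal to `ρ̂`. The fields `K_t` and
`K_φ` span a Lorentzian plane tangent to `S`, which contains a timelike vector `u` orthogonal to the
spacelike `ρ̂`; as `u^⊥` is positive definite, `v` cannot be orthogonal to `K_t`. The geodesic of `S`
with initial velocity `v` exists by Picard-Lindelöf (`LorentzianMetric.exists_geodesic`). Along it,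
`⟨γ', γ'⟩` is constant, and so is `⟨K_α, γ'⟩`
(`LorentzianMetric.hasDerivAt_val_killing`): its derivative is `⟨∇_γ' K_α, γ'⟩ + ⟨K_α, II(γ', γ')⟩`,
where the first term vanishes by Killing's equation and the second because `II` is normal and `K_α`
tangent. Hence the geodesic is null with impact parameter `ρ`, and the hypothesis gives
`II(v, v) = 0`. A symmetric bilinear map on the Lorentzian space `ρ̂^⊥` that vanishes on null vectors
is a multiple of the scalar product (`exists_eq_smul_of_null`), which is umbilicity.

The analytic input is one computation in coordinates, `christoffel_gauss_orthogonal`: for an isometric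
map `F`, the vectors `D²F(w, v) + Γ(DF w, DF v) - DF(Γ(w, v))` are orthogonal to the image of `DF`.
Applied to `f` it says that `II` is normal; applied to a change of charts it is the transformation law
of the Christoffel symbols, which makes it possible to solve the geodesic equation in one chart although
the covariant derivative is defined through the chart centred at each point.
-/

set_option synthInstance.maxHeartbeats 400000

/-! ### Christoffel symbols in coordinates -/

section CoordinateChristoffel

variable {E E₁ E₂ : Type*} [NormedAddCommGroup E] [NormedSpace ℝ E]
  [NormedAddCommGroup E₁] [NormedSpace ℝ E₁] [NormedAddCommGroup E₂] [NormedSpace ℝ E₂]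

theorem isInvertible_of_nondegenerate [FiniteDimensional ℝ E] (B : E →L[ℝ] E →L[ℝ] ℝ)
    (hB : ∀ v, (∀ w, B v w = 0) → v = 0) : B.IsInvertible := by
  have hinj : Function.Injective B.toLinearMap := by
    rw [← LinearMap.ker_eq_bot, LinearMap.ker_eq_bot']
    intro v hv
    exact hB v fun w => by
      have := congrArg (fun l : E →L[ℝ] ℝ => l w) hv
      simpa using this
  have hrank : Module.finrank ℝ E = Module.finrank ℝ (E →L[ℝ] ℝ) := by
    rw [← (LinearMap.toContinuousLinearMap (𝕜 := ℝ) (E := E) (F' := ℝ)).finrank_eq]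
    exact Subspace.dual_finrank_eq.symm
  exact ⟨(LinearEquiv.ofInjectiveOfFinrankEq B.toLinearMap hinj hrank).toContinuousLinearEquiv, by
    ext; rfl⟩

/-- The defining property of the Christoffel symbols: the Koszul formula in coordinates. -/
theorem christoffel_apply {G : E → (E →L[ℝ] E →L[ℝ] ℝ)} {u : E} (hG : (G u).IsInvertible)
    (v w y : E) :
    G u (christoffel G u v w) y =
      (1 / 2) * (fderiv ℝ G u v w y + fderiv ℝ G u w v y - fderiv ℝ G u y v w) := by
  have h := hG.self_apply_inverse ((1 / 2 : ℝ) •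
    (fderiv ℝ G u v w + fderiv ℝ G u w v - ((fderiv ℝ G u).flip v).flip w))
  rw [christoffel, h]
  simp

theorem fderiv_symm_apply {G : E → (E →L[ℝ] E →L[ℝ] ℝ)} {u : E}
    (hd : DifferentiableAt ℝ G u) (hs : ∀ u v w, G u v w = G u w v) (y v w : E) :
    fderiv ℝ G u y v w = fderiv ℝ G u y w v := by
  have hasD : ∀ a b : E, HasFDerivAt (fun x => G x a b) (((fderiv ℝ G u).flip a).flip b) u := by
    intro a b
    have h := (hd.hasFDerivAt.clm_apply (hasFDerivAt_const a u)).clm_apply (hasFDerivAt_const b u)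
    refine h.congr_fderiv ?_
    ext z
    simp
  have h1 := hasD v w
  simp only [hs _ v w] at h1
  simpa using congrArg (fun l : E →L[ℝ] ℝ => l y) (h1.unique (hasD w v))

/-- The Christoffel symbols are metric. -/
theorem fderiv_eq_christoffel_add {G : E → (E →L[ℝ] E →L[ℝ] ℝ)} {u : E}
    (hG : (G u).IsInvertible) (hd : DifferentiableAt ℝ G u)
    (hs : ∀ u v w, G u v w = G u w v) (y v w : E) :
    fderiv ℝ G u y v w = G u (christoffel G u y v) w + G u v (christoffel G u y w) := by
  rw [hs u v, christoffel_apply hG, christoffel_apply hG, fderiv_symm_apply hd hs y w v]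
  ring

theorem christoffel_comm {G : E → (E →L[ℝ] E →L[ℝ] ℝ)} {u : E}
    (hd : DifferentiableAt ℝ G u) (hs : ∀ u v w, G u v w = G u w v) (v w : E) :
    christoffel G u v w = christoffel G u w v := by
  unfold christoffel
  congr 2
  ext y
  simp [fderiv_symm_apply hd hs y v w]
  ring

theorem christoffel_add_left (G : E → (E →L[ℝ] E →L[ℝ] ℝ)) (u v v' w : E) :
    christoffel G u (v + v') w = christoffel G u v w + christoffel G u v' w := by
  unfold christoffel
  rw [← map_add, ← smul_add]
  congr 2
  ext y
  simp
  ring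

theorem christoffel_smul_left (G : E → (E →L[ℝ] E →L[ℝ] ℝ)) (u : E) (a : ℝ) (v w : E) :
    christoffel G u (a • v) w = a • christoffel G u v w := by
  unfold christoffel
  rw [← map_smul, smul_comm a]
  congr 2
  ext y
  simp
  ring

/-- The product rule for the covariant derivative along a curve, in coordinates. -/
theorem hasDerivAt_metric_apply {G : E → (E →L[ℝ] E →L[ℝ] ℝ)} {c V W : ℝ → E} {c' V' W' : E}
    {t : ℝ} (hG : (G (c t)).IsInvertible) (hd : DifferentiableAt ℝ G (c t))
    (hs : ∀ u v w, G u v w = G u w v) (hc : HasDerivAt c c' t) (hV : HasDerivAt V V' t)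
    (hW : HasDerivAt W W' t) :
    HasDerivAt (fun s => G (c s) (V s) (W s))
      (G (c t) (V' + christoffel G (c t) c' (V t)) (W t)
        + G (c t) (V t) (W' + christoffel G (c t) c' (W t))) t := by
  have hGc : HasDerivAt (fun s => G (c s)) (fderiv ℝ G (c t) c') t :=
    HasFDerivAt.comp_hasDerivAt (l := G) (l' := fderiv ℝ G (c t)) t hd.hasFDerivAt hc
  refine ((hGc.clm_apply hV).clm_apply hW).congr_deriv ?_
  simp only [map_add, add_apply]
  rw [fderiv_eq_christoffel_add hG hd hs]
  ring

/-- In coordinates, a vector `D²F(w, v) + Γ²(DF w, DF v) - DF(Γ¹(w, v))` attached to an isometric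
map `F` is orthogonal to the image of `DF`. This covers both the normality of the second fundamental
form and the transformation law of the Christoffel symbols under changes of charts. -/
theorem christoffel_gauss_orthogonal
    {G₁ : E₁ → (E₁ →L[ℝ] E₁ →L[ℝ] ℝ)} {G₂ : E₂ → (E₂ →L[ℝ] E₂ →L[ℝ] ℝ)} {F : E₁ → E₂} {u : E₁}
    (h₁ : (G₁ u).IsInvertible) (h₂ : (G₂ (F u)).IsInvertible)
    (hd₁ : DifferentiableAt ℝ G₁ u) (hd₂ : DifferentiableAt ℝ G₂ (F u))
    (hs₂ : ∀ u v w, G₂ u v w = G₂ u w v)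
    (hF : ContDiffAt ℝ 2 F u)
    (hiso : ∀ᶠ x in nhds u, ∀ v w, G₁ x v w = G₂ (F x) (fderiv ℝ F x v) (fderiv ℝ F x w))
    (v w z : E₁) :
    G₂ (F u) (fderiv ℝ (fderiv ℝ F) u w v
      + christoffel G₂ (F u) (fderiv ℝ F u w) (fderiv ℝ F u v)
      - fderiv ℝ F u (christoffel G₁ u w v)) (fderiv ℝ F u z) = 0 := by
  have hdF : DifferentiableAt ℝ F u := hF.differentiableAt (by norm_num)
  have hdF' : DifferentiableAt ℝ (fderiv ℝ F) u :=
    (hF.fderiv_right (m := 1) (by norm_num)).differentiableAt (by norm_num)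
  have hsymm : ∀ a b, fderiv ℝ (fderiv ℝ F) u a b = fderiv ℝ (fderiv ℝ F) u b a :=
    fun a b => (hF.isSymmSndFDerivAt (by simp)) a b
  -- differentiate the isometry relation
  have key : ∀ y a b, fderiv ℝ G₁ u y a b =
      fderiv ℝ G₂ (F u) (fderiv ℝ F u y) (fderiv ℝ F u a) (fderiv ℝ F u b)
        + G₂ (F u) (fderiv ℝ (fderiv ℝ F) u y a) (fderiv ℝ F u b)
        + G₂ (F u) (fderiv ℝ F u a) (fderiv ℝ (fderiv ℝ F) u y b) := by
    intro y a b
    have e1 := (hd₁.hasFDerivAt.clm_apply (hasFDerivAt_const a u)).clm_apply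
      (hasFDerivAt_const b u)
    have ev : ∀ a, HasFDerivAt (fun x => fderiv ℝ F x a)
        ((fderiv ℝ (fderiv ℝ F) u).flip a) u := fun a => by
      simpa using hdF'.hasFDerivAt.clm_apply (hasFDerivAt_const a u)
    have eG : HasFDerivAt (fun x => G₂ (F x)) ((fderiv ℝ G₂ (F u)).comp (fderiv ℝ F u)) u :=
      HasFDerivAt.comp (g := G₂) (g' := fderiv ℝ G₂ (F u)) u hd₂.hasFDerivAt hdF.hasFDerivAt
    have e2 := (eG.clm_apply (ev a)).clm_apply (ev b)
    have e3 := e2.congr_of_eventuallyEq (f₁ := fun x => G₁ x a b)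
      (hiso.mono fun x hx => hx a b)
    have := congrArg (fun l : E₁ →L[ℝ] ℝ => l y) (e1.unique e3)
    simp at this
    rw [this]
    ring
  have hi := hiso.self_of_nhds
  rw [map_sub, map_add]
  simp only [sub_apply, add_apply]
  rw [← hi, christoffel_apply h₁, christoffel_apply h₂, key, key, key, hsymm v w, hsymm z w,
    hsymm z v, hs₂ _ (fderiv ℝ F u v) (fderiv ℝ (fderiv ℝ F) u w z)]
  ring

/-- A family of linear maps on a finite-dimensional space is `C^k` at a point if all its values are. -/
theorem contDiffAt_clm_of_apply [FiniteDimensional ℝ E] {k : WithTop ℕ∞}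
    {f : E₁ → E →L[ℝ] E₂} {x : E₁}
    (h : ∀ y, ContDiffAt ℝ k (fun x => f x y) x) : ContDiffAt ℝ k f x := by
  have hd : Module.finrank ℝ E = Module.finrank ℝ (Fin (Module.finrank ℝ E) → ℝ) :=
    (Module.finrank_fin_fun ℝ).symm
  let e₁ := ContinuousLinearEquiv.ofFinrankEq hd
  let e₂ := (e₁.arrowCongr (1 : E₂ ≃L[ℝ] E₂)).trans
    (ContinuousLinearEquiv.piRing (Fin (Module.finrank ℝ E)))
  rw [← Function.id_comp f, ← e₂.symm_comp_self]
  exact e₂.symm.contDiff.contDiffAt.comp x (contDiffAt_pi.mpr fun i => h _)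

theorem contDiffAt_fderiv_fst_apply {G : E → E₂} {u : E} (hd : ContDiffAt ℝ 2 G u)
    {W : E₁ → E} {B : E₁ → E} {x : E₁} (hx : B x = u) (hB : ContDiffAt ℝ 1 B x)
    (hW : ContDiffAt ℝ 1 W x) : ContDiffAt ℝ 1 (fun p => fderiv ℝ G (B p) (W p)) x := by
  subst hx
  exact (ContDiffAt.comp x (g := fun y => fderiv ℝ G y) (hd.fderiv_right (by norm_num)) hB).clm_apply
    hW

theorem contDiffAt_christoffel [FiniteDimensional ℝ E] {G : E → (E →L[ℝ] E →L[ℝ] ℝ)} {u : E}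
    (hG : (G u).IsInvertible) (hd : ContDiffAt ℝ 2 G u) (v w : E) :
    ContDiffAt ℝ 1 (fun p : E × E × E => christoffel G p.1 p.2.1 p.2.2) (u, v, w) := by
  have h0 : ContDiffAt ℝ 1 (fun p : E × E × E => p.1) (u, v, w) := contDiffAt_fst
  have h1 : ContDiffAt ℝ 1 (fun p : E × E × E => p.2.1) (u, v, w) := contDiffAt_snd.fst
  have h2 : ContDiffAt ℝ 1 (fun p : E × E × E => p.2.2) (u, v, w) := contDiffAt_snd.snd
  have hinv : ContDiffAt ℝ 1 (fun p : E × E × E => (G p.1).inverse) (u, v, w) :=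
    ContDiffAt.comp (u, v, w) (g := fun x => (G x).inverse)
      (ContDiffAt.comp u (hG.contDiffAt_map_inverse) (hd.of_le (by norm_num))) h0
  refine hinv.clm_apply (ContDiffAt.const_smul _ (contDiffAt_clm_of_apply fun y => ?_))
  simp only [sub_apply, add_apply, ContinuousLinearMap.flip_apply]
  have hy : ContDiffAt ℝ 1 (fun _ : E × E × E => y) (u, v, w) := contDiffAt_const
  exact ((((contDiffAt_fderiv_fst_apply hd rfl h0 h1).clm_apply h2).clm_apply hy).add
    (((contDiffAt_fderiv_fst_apply hd rfl h0 h2).clm_apply h1).clm_apply hy)).sub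
    (((contDiffAt_fderiv_fst_apply hd rfl h0 hy).clm_apply h1).clm_apply h2)

/-- Local existence of geodesics in coordinates, with prescribed initial velocity. -/
theorem exists_coordinate_geodesic [FiniteDimensional ℝ E] {G : E → (E →L[ℝ] E →L[ℝ] ℝ)} {u : E}
    (hG : (G u).IsInvertible) (hd : ContDiffAt ℝ 2 G u) (v : E) :
    ∃ c c' : ℝ → E, c 0 = u ∧ c' 0 = v ∧ ∃ ε > (0 : ℝ), ∀ t ∈ Set.Ioo (-ε) ε,
      HasDerivAt c (c' t) t ∧ HasDerivAt c' (-christoffel G (c t) (c' t) (c' t)) t := by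
  have hX : ContDiffAt ℝ 1 (fun p : E × E => (p.2, -christoffel G p.1 p.2 p.2)) (u, v) := by
    refine contDiffAt_snd.prodMk (ContDiffAt.neg ?_)
    exact ContDiffAt.comp (u, v) (g := fun p : E × E × E => christoffel G p.1 p.2.1 p.2.2)
      (f := fun p : E × E => (p.1, p.2, p.2)) (contDiffAt_christoffel hG hd v v)
      (contDiffAt_fst.prodMk (contDiffAt_snd.prodMk contDiffAt_snd))
  obtain ⟨α, hα0, ε, hε, hα⟩ :=
    hX.exists_forall_mem_closedBall_exists_eq_forall_mem_Ioo_hasDerivAt₀ 0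
  refine ⟨fun t => (α t).1, fun t => (α t).2, by simp [hα0], by simp [hα0], ε, hε, fun t ht => ?_⟩
  have h := hα t (by simpa using ht)
  exact ⟨h.fst, h.snd⟩

end CoordinateChristoffel

/-! ### Lorentzian scalar products -/

section LorentzianForms

variable {T T' : Type*} [TopologicalSpace T] [AddCommGroup T] [Module ℝ T]
  [AddCommGroup T'] [Module ℝ T']

theorem IsLorentzianForm.nondegenerate {B : T →L[ℝ] T →L[ℝ] ℝ}
    (hB : IsLorentzianForm fun v w => B v w) (hs : ∀ v w, B v w = B w v) (v : T)
    (hv : ∀ w, B v w = 0) : v = 0 := by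
  obtain ⟨u, -, hu⟩ := hB
  by_contra h
  have := hu v ((hs u v).trans (hv u)) h
  simp [hv] at this

/-- In Lorentzian signature, the orthogonal complement of every timelike vector is positive
definite. -/
theorem IsLorentzianForm.pos_of_orthogonal {B : T →L[ℝ] T →L[ℝ] ℝ}
    (hB : IsLorentzianForm fun v w => B v w) (hs : ∀ v w, B v w = B w v) {u w : T}
    (hu : B u u < 0) (huw : B u w = 0) (hw : w ≠ 0) : 0 < B w w := by
  obtain ⟨e, -, he⟩ := hB
  simp only at he
  by_contra hneg
  push Not at hneg
  -- some vector of the plane spanned by `u` and `w` is orthogonal to `e`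
  have hu0 : B e u ≠ 0 := fun h => by
    have h0 : u ≠ 0 := fun h => by simp [h] at hu
    exact absurd (he u h h0) (not_lt.2 hu.le)
  set z := B e w • u - B e u • w with hz
  have hzz : B z z = (B e w) ^ 2 * B u u + (B e u) ^ 2 * B w w := by
    simp [hz, huw, hs w u]
    ring
  have hz0 : z ≠ 0 := fun h => by
    have h1 : B u z = 0 := by simp [h]
    simp [hz, huw, hu.ne] at h1
    rw [hz, h1, zero_smul, zero_sub, neg_eq_zero, smul_eq_zero] at h
    exact h.elim hu0 hw
  have := he z (by simp [hz]; ring) hz0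
  nlinarith [sq_nonneg (B e w), sq_nonneg (B e u)]

/-- If the plane spanned by `a` and `b` is Lorentzian (its Gram determinant is negative) and `b` is
spacelike, then the plane contains a timelike vector orthogonal to `b`. -/
theorem exists_timelike_orthogonal {B : T →L[ℝ] T →L[ℝ] ℝ} (hs : ∀ v w, B v w = B w v) {a b : T}
    (hdet : B a a * B b b - B a b * B a b < 0) (hb : 0 < B b b) :
    ∃ x y : ℝ, B (x • a + y • b) (x • a + y • b) < 0 ∧ B b (x • a + y • b) = 0 := by
  refine ⟨B b b, -B a b, ?_, ?_⟩
  · have : B (B b b • a + (-B a b) • b) (B b b • a + (-B a b) • b)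
        = B b b * (B a a * B b b - B a b * B a b) := by
      simp [hs b a]
      ring
    rw [this]
    exact mul_neg_of_pos_of_neg hb hdet
  · simp [hs b a]
    ring

/-- A symmetric bilinear map that vanishes on the null vectors of a subspace `V` containing a timelike
vector `u` is, on `V`, a multiple of the scalar product. -/
theorem exists_eq_smul_of_null {B : T →L[ℝ] T →L[ℝ] ℝ}
    (hB : IsLorentzianForm fun v w => B v w) (hs : ∀ v w, B v w = B w v)
    (V : Submodule ℝ T) {u : T} (huV : u ∈ V) (hu : B u u < 0)
    (Q : T →ₗ[ℝ] T →ₗ[ℝ] T') (hQ : ∀ v w, Q v w = Q w v)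
    (hnull : ∀ v ∈ V, B v v = 0 → Q v v = 0) {v w : T} (hv : v ∈ V) (hw : w ∈ V) :
    Q v w = B v w • ((B u u)⁻¹ • Q u u) := by
  set H := (B u u)⁻¹ • Q u u with hH
  have hQu : Q u u = B u u • H := by rw [hH, smul_inv_smul₀ hu.ne]
  -- `a u ± x` is null for a suitable `a` when `x` is orthogonal to `u`
  have hperp : ∀ x ∈ V, B u x = 0 → Q x x = B x x • H ∧ Q u x = 0 := by
    intro x hx hux
    by_cases hx0 : x = 0
    · simp [hx0]
    have hpos := hB.pos_of_orthogonal hs hu hux hx0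
    set a := Real.sqrt (B x x / -B u u) with ha
    have ha2 : a ^ 2 = B x x / -B u u := Real.sq_sqrt (div_nonneg hpos.le (by linarith))
    have ha0 : a ≠ 0 := fun h => by
      rw [h] at ha2
      have : 0 < B x x / -B u u := div_pos hpos (by linarith)
      linarith [ha2, this, sq (0 : ℝ)]
    have ha3 : a ^ 2 * B u u = -B x x := by
      rw [ha2]; field_simp [hu.ne]
    have hxu : B x u = 0 := by rw [hs, hux]
    have hp := hnull (a • u + x) (V.add_mem (V.smul_mem a huV) hx) (by
      simp [hux, hxu]; linarith)
    have hm := hnull (a • u - x) (V.sub_mem (V.smul_mem a huV) hx) (by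
      simp [hux, hxu]; linarith)
    simp only [map_add, map_sub, map_smul, LinearMap.add_apply, LinearMap.sub_apply,
      LinearMap.smul_apply, hQ x u] at hp hm
    have h2 : (2 : ℝ) • (Q x x - B x x • H) = 0 := by
      have hsum := congrArg₂ (fun p q : T' => p + q) hp hm
      simp only [add_zero] at hsum
      rw [← hsum, ← neg_eq_iff_eq_neg.2 ha3, hQu]
      module
    have h4 : (4 * a) • Q u x = 0 := by
      have := congrArg₂ (fun p q : T' => p - q) hp hm
      simp only [sub_zero] at this
      rw [← this]
      module
    constructor
    · exact sub_eq_zero.1 ((smul_eq_zero.1 h2).resolve_left two_ne_zero)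
    · exact (smul_eq_zero.1 h4).resolve_left (mul_ne_zero four_ne_zero ha0)
  -- quadratic form on all of `V`
  have hdiag : ∀ x ∈ V, Q x x = B x x • H := by
    intro x hx
    -- split off the component of `x` along `u`
    set c := B u x / B u u with hc
    have hcu : c * B u u = B u x := div_mul_cancel₀ _ hu.ne
    obtain ⟨y, hy⟩ : ∃ y, x = c • u + y := ⟨x - c • u, by abel⟩
    have hyV : y ∈ V := by
      have : y = x - c • u := by rw [hy]; abel
      rw [this]
      exact V.sub_mem hx (V.smul_mem c huV)
    have huy : B u y = 0 := by
      have := hcu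
      rw [hy] at this
      simp at this
      exact this
    obtain ⟨h1, h2⟩ := hperp y hyV huy
    rw [hy]
    simp only [map_add, map_smul, LinearMap.add_apply, LinearMap.smul_apply, hQ y u, h1, h2, hQu,
      add_apply, smul_apply, hs y u, huy]
    simp only [smul_eq_mul]
    module
  have h := hdiag (v + w) (V.add_mem hv hw)
  simp only [map_add, LinearMap.add_apply, add_apply, hdiag v hv, hdiag w hw, hQ w v, hs w v] at h
  have h2 : (2 : ℝ) • (Q v w - B v w • H) = 0 := by
    have h' := sub_eq_zero.2 h
    rw [← h']
    module
  exact sub_eq_zero.1 ((smul_eq_zero.1 h2).resolve_left two_ne_zero)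

end LorentzianForms

/-! ### Charts and the metric in a chart -/

section Coordinates

variable {m : ℕ} {M : Type*} [TopologicalSpace M] [ChartedSpace (EuclideanSpace ℝ (Fin m)) M]

theorem range_modelEuclidean : Set.range (𝓡 m) = Set.univ := by simp

theorem ofCoord_eq_mfderivWithin (q : M) (u : EuclideanSpace ℝ (Fin m)) :
    ofCoord q u = mfderivWithin 𝓘(ℝ, EuclideanSpace ℝ (Fin m)) (𝓡 m) (extChartAt (𝓡 m) q).symm
      (Set.range (𝓡 m)) u := by
  rw [range_modelEuclidean, mfderivWithin_univ]; rfl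

variable [IsManifold (𝓡 m) ∞ M]

theorem isManifold_one : IsManifold (𝓡 m) 1 M := IsManifold.of_le (n := ∞) (by norm_num)

theorem toCoord_self (q : M) (v : TangentSpace (𝓡 m) q) : toCoord q q v = v := by
  have : IsManifold (𝓡 m) 1 M := isManifold_one
  exact congrArg (fun l : TangentSpace (𝓡 m) q →L[ℝ] EuclideanSpace ℝ (Fin m) => l v)
    (mfderiv_extChartAt_self (I := 𝓡 m) (x := q))

theorem ofCoord_toCoord (q : M) {u : EuclideanSpace ℝ (Fin m)}
    (hu : u ∈ (extChartAt (𝓡 m) q).target)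
    (v : TangentSpace (𝓡 m) ((extChartAt (𝓡 m) q).symm u)) :
    ofCoord q u (toCoord q ((extChartAt (𝓡 m) q).symm u) v) = v := by
  have : IsManifold (𝓡 m) 1 M := isManifold_one
  rw [ofCoord_eq_mfderivWithin]
  exact DFunLike.congr_fun (mfderivWithin_extChartAt_symm_comp_mfderiv_extChartAt hu) v

theorem toCoord_ofCoord (q : M) {u : EuclideanSpace ℝ (Fin m)}
    (hu : u ∈ (extChartAt (𝓡 m) q).target) (v : EuclideanSpace ℝ (Fin m)) :
    toCoord q ((extChartAt (𝓡 m) q).symm u) (ofCoord q u v) = v := by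
  have : IsManifold (𝓡 m) 1 M := isManifold_one
  rw [ofCoord_eq_mfderivWithin]
  exact DFunLike.congr_fun (mfderiv_extChartAt_comp_mfderivWithin_extChartAt_symm hu) v

/-- The components of the derivative of a map `c` are the derivatives of the coordinates of `c`. -/
theorem mfderiv_extChartAt_comp {F H : Type*} [NormedAddCommGroup F] [NormedSpace ℝ F]
    [TopologicalSpace H] {J : ModelWithCorners ℝ F H} {N : Type*} [TopologicalSpace N]
    [ChartedSpace H N] {c : N → M} {p : N} {q : M} (hc : MDifferentiableAt J (𝓡 m) c p)
    (hq : c p ∈ (extChartAt (𝓡 m) q).source) (v : TangentSpace J p) :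
    mfderiv J 𝓘(ℝ, EuclideanSpace ℝ (Fin m)) (fun x => extChartAt (𝓡 m) q (c x)) p v =
      toCoord q (c p) (mfderiv J (𝓡 m) c p v) := by
  have : IsManifold (𝓡 m) 1 M := isManifold_one
  have h := mfderiv_comp p (mdifferentiableAt_extChartAt (I := 𝓡 m) (x := q)
    (by rwa [extChartAt_source] at hq)) hc
  exact DFunLike.congr_fun h v

namespace LorentzianMetric

variable (g : LorentzianMetric m M)

theorem inChart_symm (q : M) (u v w : EuclideanSpace ℝ (Fin m)) :
    g.inChart q u v w = g.inChart q u w v := by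
  rw [inChart_apply, inChart_apply, g.symm]

theorem inChart_toCoord (q : M) {x : M} (hx : x ∈ (extChartAt (𝓡 m) q).source)
    (v w : TangentSpace (𝓡 m) x) :
    g.inChart q (extChartAt (𝓡 m) q x) (toCoord q x v) (toCoord q x w) = g.val x v w := by
  obtain ⟨u, hu, rfl⟩ : ∃ u ∈ (extChartAt (𝓡 m) q).target, x = (extChartAt (𝓡 m) q).symm u :=
    ⟨_, (extChartAt (𝓡 m) q).map_source hx, ((extChartAt (𝓡 m) q).left_inv hx).symm⟩
  rw [(extChartAt (𝓡 m) q).right_inv hu, inChart_apply, ofCoord_toCoord q hu,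
    ofCoord_toCoord q hu]

theorem inChart_self (q : M) (v w : TangentSpace (𝓡 m) q) :
    g.inChart q (extChartAt (𝓡 m) q q) v w = g.val q v w := by
  have h := g.inChart_toCoord q (mem_extChartAt_source q) v w
  rwa [toCoord_self, toCoord_self] at h

theorem nondegenerate (x : M) (v : TangentSpace (𝓡 m) x) (hv : ∀ w, g.val x v w = 0) : v = 0 :=
  (g.lorentzian x).nondegenerate (g.symm x) v hv

theorem inChart_isInvertible (q : M) {u : EuclideanSpace ℝ (Fin m)}
    (hu : u ∈ (extChartAt (𝓡 m) q).target) : (g.inChart q u).IsInvertible := by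
  refine isInvertible_of_nondegenerate _ fun v hv => ?_
  have h0 : ofCoord q u v = 0 := g.nondegenerate _ _ fun w => by
    have := hv (toCoord q _ w)
    rwa [inChart_apply, ofCoord_toCoord q hu] at this
  rw [← toCoord_ofCoord q hu v, h0, map_zero]

theorem contDiffAt_inChart (q : M) {u : EuclideanSpace ℝ (Fin m)}
    (hu : u ∈ (extChartAt (𝓡 m) q).target) : ContDiffAt ℝ 2 (g.inChart q) u := by
  have : IsManifold (𝓡 m) 1 M := isManifold_one
  refine contDiffAt_clm_of_apply fun v => contDiffAt_clm_of_apply fun w => ?_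
  have hsymm : ContMDiffOn 𝓘(ℝ, EuclideanSpace ℝ (Fin m)) (𝓡 m) ∞ (extChartAt (𝓡 m) q).symm
      (extChartAt (𝓡 m) q).target := contMDiffOn_extChartAt_symm q
  have hopen : IsOpen (extChartAt (𝓡 m) q).target := isOpen_extChartAt_target q
  have hat : ContMDiffAt 𝓘(ℝ, EuclideanSpace ℝ (Fin m)) (𝓡 m) ∞ (extChartAt (𝓡 m) q).symm u :=
    hsymm.contMDiffAt (hopen.mem_nhds hu)
  have hV : ∀ v : EuclideanSpace ℝ (Fin m), ContMDiffAt 𝓘(ℝ, EuclideanSpace ℝ (Fin m))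
      ((𝓡 m).prod 𝓘(ℝ, EuclideanSpace ℝ (Fin m))) 2
      (fun x => TotalSpace.mk' (EuclideanSpace ℝ (Fin m)) (E := TangentSpace (𝓡 m))
        ((extChartAt (𝓡 m) q).symm x) (ofCoord q x v)) u := by
    intro v
    -- `ofCoord q x v` is the tangent map of the inverse chart, applied to the constant field `v`
    have hT := (hsymm.of_le (m := 3) (by norm_cast)).contMDiffOn_tangentMapWithin (m := 2)
      (by norm_num) hopen.uniqueMDiffOn
    have hs : ContMDiffAt 𝓘(ℝ, EuclideanSpace ℝ (Fin m))
        𝓘(ℝ, EuclideanSpace ℝ (Fin m)).tangent 2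
        (fun x : EuclideanSpace ℝ (Fin m) => (⟨x, v⟩ : TangentBundle
          𝓘(ℝ, EuclideanSpace ℝ (Fin m)) (EuclideanSpace ℝ (Fin m)))) u :=
      (contMDiffAt_vectorSpace_iff_contDiffAt (V := fun _ => v)).2 contDiffAt_const
    have hnhds : TotalSpace.proj ⁻¹' (extChartAt (𝓡 m) q).target ∈ nhds (⟨u, v⟩ : TangentBundle
          𝓘(ℝ, EuclideanSpace ℝ (Fin m)) (EuclideanSpace ℝ (Fin m))) :=
      ((hopen.preimage (FiberBundle.continuous_proj (EuclideanSpace ℝ (Fin m)) (TangentSpace 𝓘(ℝ, EuclideanSpace ℝ (Fin m))))).mem_nhds hu)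
    refine ((hT.contMDiffAt hnhds).comp u hs).congr_of_eventuallyEq ?_
    filter_upwards [hopen.mem_nhds hu] with x hx
    have : mfderivWithin 𝓘(ℝ, EuclideanSpace ℝ (Fin m)) (𝓡 m) (extChartAt (𝓡 m) q).symm
        (extChartAt (𝓡 m) q).target x = ofCoord q x :=
      mfderivWithin_of_isOpen hopen hx
    simp only [Function.comp_apply, tangentMapWithin, this]
    rfl
  have h := ContMDiffAt.clm_bundle_apply₂ (F₁ := EuclideanSpace ℝ (Fin m))
    (F₂ := EuclideanSpace ℝ (Fin m)) (F₃ := ℝ) (E₁ := TangentSpace (𝓡 m))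
    (E₂ := TangentSpace (𝓡 m)) (E₃ := Bundle.Trivial M ℝ)
    (((g.smooth.of_le (by norm_cast)).contMDiffAt).comp u (hat.of_le (by norm_cast))) (hV v) (hV w)
  simp only [contMDiffAt_totalSpace] at h
  exact h.2.contDiffAt

end LorentzianMetric

end Coordinates

/-! ### Covariant derivatives along curves -/

section Curves

variable {m : ℕ} {M : Type*} [TopologicalSpace M] [ChartedSpace (EuclideanSpace ℝ (Fin m)) M]
  [IsManifold (𝓡 m) ∞ M]

theorem hasDerivAt_extChartAt_comp {γ : ℝ → M} {t : ℝ} {q : M}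
    (hγ : MDifferentiableAt 𝓘(ℝ, ℝ) (𝓡 m) γ t) (hq : γ t ∈ (extChartAt (𝓡 m) q).source) :
    HasDerivAt (fun s => extChartAt (𝓡 m) q (γ s)) (toCoord q (γ t) (velocity m γ t)) t := by
  have : IsManifold (𝓡 m) 1 M := isManifold_one
  have hd : MDifferentiableAt 𝓘(ℝ, ℝ) 𝓘(ℝ, EuclideanSpace ℝ (Fin m))
      (fun s => extChartAt (𝓡 m) q (γ s)) t :=
    (mdifferentiableAt_extChartAt (I := 𝓡 m) (x := q)
      (by rwa [extChartAt_source] at hq)).comp t hγ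
  have h := mfderiv_extChartAt_comp hγ hq (1 : ℝ)
  rw [mfderiv_eq_fderiv] at h
  have h2 := hd.differentiableAt.hasFDerivAt.hasDerivAt
  exact h2.congr_deriv h

omit [IsManifold (𝓡 m) ∞ M] in
theorem eventually_mem_extChartAt_source {γ : ℝ → M} {t : ℝ} (hγ : ContinuousAt γ t) {q : M}
    (hq : γ t ∈ (extChartAt (𝓡 m) q).source) :
    ∀ᶠ s in nhds t, γ s ∈ (extChartAt (𝓡 m) q).source :=
  hγ.eventually ((isOpen_extChartAt_source q).mem_nhds hq)

theorem contDiffAt_extChartAt_comp {γ : ℝ → M} {t : ℝ} {k : WithTop ℕ∞} (hk : k ≤ ∞)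
    (hγ : ContMDiffAt 𝓘(ℝ, ℝ) (𝓡 m) k γ t) {q : M}
    (hq : γ t ∈ (extChartAt (𝓡 m) q).source) :
    ContDiffAt ℝ k (fun s => extChartAt (𝓡 m) q (γ s)) t := by
  have : IsManifold (𝓡 m) k M := IsManifold.of_le hk
  exact ((contMDiffAt_extChartAt' (by rwa [extChartAt_source] at hq)).comp t hγ).contDiffAt

theorem eventually_mdifferentiableAt {γ : ℝ → M} {t : ℝ}
    (hγ : ContMDiffAt 𝓘(ℝ, ℝ) (𝓡 m) 2 γ t) :
    ∀ᶠ s in nhds t, MDifferentiableAt 𝓘(ℝ, ℝ) (𝓡 m) γ s := by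
  have : IsManifold (𝓡 m) 2 M := IsManifold.of_le (n := ∞) (by norm_cast)
  exact (contMDiffAt_iff_contMDiffAt_nhds (by norm_num) |>.1 hγ).mono fun s hs => hs.mdifferentiableAt (by norm_num)

theorem eventually_deriv_eq_toCoord_velocity {γ : ℝ → M} {t : ℝ}
    (hγ : ContMDiffAt 𝓘(ℝ, ℝ) (𝓡 m) 2 γ t) {q : M}
    (hq : γ t ∈ (extChartAt (𝓡 m) q).source) :
    (fun s => toCoord q (γ s) (velocity m γ s)) =ᶠ[nhds t]
      deriv fun s => extChartAt (𝓡 m) q (γ s) := by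
  filter_upwards [eventually_mdifferentiableAt hγ,
    eventually_mem_extChartAt_source hγ.continuousAt hq] with s h1 h2
  exact (hasDerivAt_extChartAt_comp h1 h2).deriv.symm

theorem differentiableAt_toCoord_velocity {γ : ℝ → M} {t : ℝ}
    (hγ : ContMDiffAt 𝓘(ℝ, ℝ) (𝓡 m) 2 γ t) {q : M}
    (hq : γ t ∈ (extChartAt (𝓡 m) q).source) :
    DifferentiableAt ℝ (fun s => toCoord q (γ s) (velocity m γ s)) t := by
  refine DifferentiableAt.congr_of_eventuallyEq ?_ (eventually_deriv_eq_toCoord_velocity hγ hq)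
  have h := contDiffAt_extChartAt_comp (by norm_cast) hγ hq
  exact ((h.fderiv_right (m := 1) (by norm_num)).clm_apply
    (contDiffAt_const (c := (1 : ℝ)))).differentiableAt (by norm_num)

namespace LorentzianMetric

variable (g : LorentzianMetric m M)

theorem covDerivAlong_real (γ : ℝ → M) (W : ∀ s : ℝ, TangentSpace (𝓡 m) (γ s)) (t : ℝ) :
    g.covDerivAlong 𝓘(ℝ, ℝ) γ W t (1 : ℝ) =
      (deriv (fun s => toCoord (γ t) (γ s) (W s)) t
        + christoffel (g.inChart (γ t)) (extChartAt (𝓡 m) (γ t) (γ t)) (velocity m γ t) (W t) :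
        EuclideanSpace ℝ (Fin m)) := by
  unfold covDerivAlong
  rw [mfderiv_eq_fderiv]
  rfl

/-- The covariant acceleration of a curve, in the chart at the point where it is computed. -/
theorem covDerivAlong_velocity {γ : ℝ → M} {t : ℝ} (hγ : ContMDiffAt 𝓘(ℝ, ℝ) (𝓡 m) 2 γ t) :
    g.covDerivAlong 𝓘(ℝ, ℝ) γ (velocity m γ) t (1 : ℝ) =
      (deriv (deriv fun s => extChartAt (𝓡 m) (γ t) (γ s)) t
        + christoffel (g.inChart (γ t)) (extChartAt (𝓡 m) (γ t) (γ t))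
          (deriv (fun s => extChartAt (𝓡 m) (γ t) (γ s)) t)
          (deriv (fun s => extChartAt (𝓡 m) (γ t) (γ s)) t) : EuclideanSpace ℝ (Fin m)) := by
  have h := eventually_deriv_eq_toCoord_velocity hγ (mem_extChartAt_source (I := 𝓡 m) (γ t))
  rw [covDerivAlong_real, h.deriv_eq, ← h.self_of_nhds]
  simp only [toCoord_self]
  rfl

/-- The Levi-Civita connection is metric: the product rule along curves. -/
theorem hasDerivAt_val {γ : ℝ → M} {t : ℝ} (hγ : MDifferentiableAt 𝓘(ℝ, ℝ) (𝓡 m) γ t)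
    {V W : ∀ s : ℝ, TangentSpace (𝓡 m) (γ s)}
    (hV : DifferentiableAt ℝ (fun s => toCoord (γ t) (γ s) (V s)) t)
    (hW : DifferentiableAt ℝ (fun s => toCoord (γ t) (γ s) (W s)) t) :
    HasDerivAt (fun s => g.val (γ s) (V s) (W s))
      (g.val (γ t) (g.covDerivAlong 𝓘(ℝ, ℝ) γ V t (1 : ℝ)) (W t)
        + g.val (γ t) (V t) (g.covDerivAlong 𝓘(ℝ, ℝ) γ W t (1 : ℝ))) t := by
  have hq := mem_extChartAt_source (I := 𝓡 m) (γ t)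
  have hu := (extChartAt (𝓡 m) (γ t)).map_source hq
  have hG : DifferentiableAt ℝ (g.inChart (γ t)) (extChartAt (𝓡 m) (γ t) (γ t)) :=
    (g.contDiffAt_inChart _ hu).differentiableAt (by norm_num)
  have h := hasDerivAt_metric_apply (G := g.inChart (γ t)) (g.inChart_isInvertible _ hu) hG
    (g.inChart_symm _) (hasDerivAt_extChartAt_comp hγ hq) hV.hasDerivAt hW.hasDerivAt
  have hev : (fun s => g.val (γ s) (V s) (W s)) =ᶠ[nhds t] fun s =>
      g.inChart (γ t) (extChartAt (𝓡 m) (γ t) (γ s)) (toCoord (γ t) (γ s) (V s))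
        (toCoord (γ t) (γ s) (W s)) :=
    (eventually_mem_extChartAt_source hγ.continuousAt hq).mono fun s hs =>
      (g.inChart_toCoord _ hs _ _).symm
  refine (h.congr_of_eventuallyEq hev).congr_deriv ?_
  rw [← g.inChart_self, ← g.inChart_self, covDerivAlong_real, covDerivAlong_real]
  simp only [toCoord_self]

end LorentzianMetric

end Curves

/-! ### Isometric maps in charts -/

section CoordinateExpression

variable {E₁ E₂ : Type*} [NormedAddCommGroup E₁] [NormedSpace ℝ E₁]
  [NormedAddCommGroup E₂] [NormedSpace ℝ E₂]

theorem fderiv_clm_apply_const {A : E₁ → E₁ →L[ℝ] E₂} {x : E₁} (hA : DifferentiableAt ℝ A x)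
    (v : E₁) : fderiv ℝ (fun u => A u v) x = (fderiv ℝ A x).flip v := by
  simpa using (hA.hasFDerivAt.clm_apply (hasFDerivAt_const v x)).fderiv

/-- First and second derivatives of a curve composed with a map. -/
theorem deriv_deriv_comp {F : E₁ → E₂} {c : ℝ → E₁} {t : ℝ} (hF : ContDiffAt ℝ 2 F (c t))
    (hc : ContDiffAt ℝ 2 c t) :
    deriv (fun s => F (c s)) t = fderiv ℝ F (c t) (deriv c t) ∧
    deriv (deriv fun s => F (c s)) t =
      fderiv ℝ (fderiv ℝ F) (c t) (deriv c t) (deriv c t)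
        + fderiv ℝ F (c t) (deriv (deriv c) t) := by
  have hev : (deriv fun s => F (c s)) =ᶠ[nhds t] fun s => fderiv ℝ F (c s) (deriv c s) := by
    filter_upwards [hc.continuousAt.eventually (hF.eventually (by norm_num)),
      hc.eventually (by norm_num)] with s h1 h2
    exact (HasFDerivAt.comp_hasDerivAt (l := F) s (h1.differentiableAt (by norm_num)).hasFDerivAt
      (h2.differentiableAt (by norm_num)).hasDerivAt).deriv
  refine ⟨hev.self_of_nhds, ?_⟩
  have hc1 : HasDerivAt c (deriv c t) t := (hc.differentiableAt (by norm_num)).hasDerivAt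
  have hc2 : HasDerivAt (deriv c) (deriv (deriv c) t) t :=
    (((hc.fderiv_right (m := 1) (by norm_num)).clm_apply
      (contDiffAt_const (c := (1 : ℝ)))).differentiableAt (by norm_num)).hasDerivAt
  have hF1 : HasFDerivAt (fderiv ℝ F) (fderiv ℝ (fderiv ℝ F) (c t)) (c t) :=
    ((hF.fderiv_right (m := 1) (by norm_num)).differentiableAt (by norm_num)).hasFDerivAt
  rw [hev.deriv_eq]
  exact ((HasFDerivAt.comp_hasDerivAt t hF1 hc1).clm_apply hc2).deriv

variable {m n : ℕ} {M : Type*} [TopologicalSpace M]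
  [ChartedSpace (EuclideanSpace ℝ (Fin m)) M]
  {S : Type*} [TopologicalSpace S] [ChartedSpace (EuclideanSpace ℝ (Fin n)) S]

/-- The map `f` written in the preferred charts at `p` and `q`. -/
noncomputable def coordMap (f : S → M) (p : S) (q : M) (u : EuclideanSpace ℝ (Fin n)) :
    EuclideanSpace ℝ (Fin m) :=
  extChartAt (𝓡 m) q (f ((extChartAt (𝓡 n) p).symm u))

theorem coordMap_extChartAt (f : S → M) {p x : S} (q : M) (hx : x ∈ (extChartAt (𝓡 n) p).source) :
    coordMap f p q (extChartAt (𝓡 n) p x) = extChartAt (𝓡 m) q (f x) := by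
  rw [coordMap, (extChartAt (𝓡 n) p).left_inv hx]

variable [IsManifold (𝓡 m) ∞ M] [IsManifold (𝓡 n) ∞ S] {f : S → M}

theorem contDiffAt_coordMap (hf : ContMDiff (𝓡 n) (𝓡 m) ∞ f) {p x : S} {q : M}
    (hx : x ∈ (extChartAt (𝓡 n) p).source) (hq : f x ∈ (extChartAt (𝓡 m) q).source) :
    ContDiffAt ℝ ∞ (coordMap (m := m) (n := n) f p q) (extChartAt (𝓡 n) p x) := by
  have hs : ContMDiffAt 𝓘(ℝ, EuclideanSpace ℝ (Fin n)) (𝓡 n) ∞ (extChartAt (𝓡 n) p).symm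
      (extChartAt (𝓡 n) p x) :=
    (contMDiffOn_extChartAt_symm p).contMDiffAt
      ((isOpen_extChartAt_target p).mem_nhds ((extChartAt (𝓡 n) p).map_source hx))
  have hl := (extChartAt (𝓡 n) p).left_inv hx
  have h1 : ContMDiffAt 𝓘(ℝ, EuclideanSpace ℝ (Fin n)) (𝓡 m) ∞
      (fun u => f ((extChartAt (𝓡 n) p).symm u)) (extChartAt (𝓡 n) p x) := hf.contMDiffAt.comp _ hs
  have h2 : ContMDiffAt (𝓡 m) 𝓘(ℝ, EuclideanSpace ℝ (Fin m)) ∞ (extChartAt (𝓡 m) q)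
      (f ((extChartAt (𝓡 n) p).symm (extChartAt (𝓡 n) p x))) := by
    rw [hl]
    exact contMDiffAt_extChartAt' (by rwa [extChartAt_source] at hq)
  exact (ContMDiffAt.comp (g := extChartAt (𝓡 m) q)
    (f := fun u => f ((extChartAt (𝓡 n) p).symm u)) _ h2 h1).contDiffAt

theorem fderiv_coordMap_toCoord (hf : ContMDiff (𝓡 n) (𝓡 m) ∞ f) {p x : S} {q : M}
    (hx : x ∈ (extChartAt (𝓡 n) p).source) (hq : f x ∈ (extChartAt (𝓡 m) q).source)
    (v : TangentSpace (𝓡 n) x) :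
    fderiv ℝ (coordMap f p q) (extChartAt (𝓡 n) p x) (toCoord p x v) =
      toCoord q (f x) (mfderiv (𝓡 n) (𝓡 m) f x v) := by
  have : IsManifold (𝓡 n) 1 S := isManifold_one
  have hev : (fun y => coordMap f p q (extChartAt (𝓡 n) p y)) =ᶠ[nhds x]
      fun y => extChartAt (𝓡 m) q (f y) :=
    Filter.mem_of_superset ((isOpen_extChartAt_source p).mem_nhds hx) fun y hy =>
      coordMap_extChartAt f q hy
  have h1 := mfderiv_extChartAt_comp (hf.mdifferentiableAt (by norm_num)) hq v
  rw [← h1, ← hev.mfderiv_eq]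
  have h2 := mfderiv_comp x (I' := 𝓘(ℝ, EuclideanSpace ℝ (Fin n)))
    (I'' := 𝓘(ℝ, EuclideanSpace ℝ (Fin m))) (g := coordMap f p q)
    ((contDiffAt_coordMap hf hx hq).differentiableAt (by norm_num)).mdifferentiableAt
    (mdifferentiableAt_extChartAt (I := 𝓡 n) (x := p) (by rwa [extChartAt_source] at hx))
  rw [mfderiv_eq_fderiv] at h2
  exact (DFunLike.congr_fun h2 v).symm

namespace LorentzianMetric

variable {h : LorentzianMetric n S} {g : LorentzianMetric m M}

/-- In charts, the metric of `S` is the pullback of the metric of `M` by an isometric map. -/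
theorem eventually_inChart_eq (hf : ContMDiff (𝓡 n) (𝓡 m) ∞ f)
    (hiso : ∀ (p : S) (v w : TangentSpace (𝓡 n) p),
      h.val p v w = g.val (f p) (mfderiv (𝓡 n) (𝓡 m) f p v) (mfderiv (𝓡 n) (𝓡 m) f p w))
    {p x : S} {q : M}
    (hx : x ∈ (extChartAt (𝓡 n) p).source) (hq : f x ∈ (extChartAt (𝓡 m) q).source) :
    ∀ᶠ u in nhds (extChartAt (𝓡 n) p x), ∀ v w, h.inChart p u v w =
      g.inChart q (coordMap f p q u) (fderiv ℝ (coordMap f p q) u v)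
        (fderiv ℝ (coordMap f p q) u w) := by
  have hu := (extChartAt (𝓡 n) p).map_source hx
  have hcont : ContinuousAt (fun u => f ((extChartAt (𝓡 n) p).symm u)) (extChartAt (𝓡 n) p x) := by
    refine ContinuousAt.comp (f := (extChartAt (𝓡 n) p).symm) hf.continuous.continuousAt
      (continuousAt_extChartAt_symm' hx)
  filter_upwards [(isOpen_extChartAt_target p).mem_nhds hu, hcont.eventually_mem
    ((isOpen_extChartAt_source (I := 𝓡 m) q).mem_nhds
      (by rwa [(extChartAt (𝓡 n) p).left_inv hx]))] with u hut huq v w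
  have hus := (extChartAt (𝓡 n) p).map_target hut
  have hr := (extChartAt (𝓡 n) p).right_inv hut
  have key : ∀ v, fderiv ℝ (coordMap f p q) u v = toCoord q (f ((extChartAt (𝓡 n) p).symm u))
      (mfderiv (𝓡 n) (𝓡 m) f ((extChartAt (𝓡 n) p).symm u) (ofCoord p u v)) := by
    intro v
    have := fderiv_coordMap_toCoord hf hus huq (ofCoord p u v)
    rwa [hr, toCoord_ofCoord p hut] at this
  rw [key, key, coordMap, g.inChart_toCoord q huq, inChart_apply, hiso]

/-- A curve that solves the geodesic equation at `t` in some chart satisfies `∇_γ' γ' = 0` there, although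
the latter is computed in the preferred chart at `γ t`: the identity of `S`, written in these two
charts, is isometric. -/
theorem covDerivAlong_velocity_eq_zero {γ : ℝ → S} {t : ℝ}
    (hγ : ContMDiffAt 𝓘(ℝ, ℝ) (𝓡 n) 2 γ t) {p : S} (hp : γ t ∈ (extChartAt (𝓡 n) p).source)
    (heq : deriv (deriv fun s => extChartAt (𝓡 n) p (γ s)) t
        + christoffel (h.inChart p) (extChartAt (𝓡 n) p (γ t))
          (deriv (fun s => extChartAt (𝓡 n) p (γ s)) t)
          (deriv (fun s => extChartAt (𝓡 n) p (γ s)) t) = 0) :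
    h.covDerivAlong 𝓘(ℝ, ℝ) γ (velocity n γ) t (1 : ℝ) = 0 := by
  have hq := mem_extChartAt_source (I := 𝓡 n) (γ t)
  have hid : ContMDiff (𝓡 n) (𝓡 n) ∞ (id : S → S) := contMDiff_id
  have hF : ContDiffAt ℝ ∞ (coordMap (m := n) (n := n) id p (γ t)) (extChartAt (𝓡 n) p (γ t)) :=
    contDiffAt_coordMap hid hp hq
  have hF2 : ContDiffAt ℝ 2 (coordMap (m := n) (n := n) id p (γ t)) (extChartAt (𝓡 n) p (γ t)) :=
    hF.of_le (by norm_cast)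
  have hFp : coordMap (m := n) (n := n) id p (γ t) (extChartAt (𝓡 n) p (γ t)) =
      extChartAt (𝓡 n) (γ t) (γ t) := coordMap_extChartAt id (γ t) hp
  have hev : (fun s => extChartAt (𝓡 n) (γ t) (γ s)) =ᶠ[nhds t]
      fun s => coordMap (m := n) (n := n) id p (γ t) (extChartAt (𝓡 n) p (γ s)) :=
    (eventually_mem_extChartAt_source hγ.continuousAt hp).mono fun s hs =>
      (coordMap_extChartAt id (γ t) hs).symm
  have hiso := eventually_inChart_eq (h := h) (g := h) hid (fun p v w => by
    rw [mfderiv_id]; rfl) hp hq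
  have hc := contDiffAt_extChartAt_comp (by norm_cast) hγ hp
  obtain ⟨e1, e2⟩ := deriv_deriv_comp hF2 hc
  have hu := (extChartAt (𝓡 n) p).map_source hp
  have hu' := (extChartAt (𝓡 n) (γ t)).map_source hq
  rw [covDerivAlong_velocity h hγ, hev.deriv.deriv_eq, hev.deriv_eq, e1, e2, ← hFp]
  rw [← hFp] at hu'
  -- the acceleration is orthogonal to the image of the derivative of the change of charts
  have horth := christoffel_gauss_orthogonal (h.inChart_isInvertible p hu)
    (h.inChart_isInvertible (γ t) hu') ((h.contDiffAt_inChart p hu).differentiableAt (by norm_num))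
    ((h.contDiffAt_inChart (γ t) hu').differentiableAt (by norm_num)) (h.inChart_symm _) hF2 hiso
    (deriv (fun s => extChartAt (𝓡 n) p (γ s)) t) (deriv (fun s => extChartAt (𝓡 n) p (γ s)) t)
  rw [add_eq_zero_iff_eq_neg] at heq
  rw [heq, map_neg, add_right_comm, ← sub_eq_add_neg]
  refine (h.inChart_isInvertible (γ t) hu').injective (ContinuousLinearMap.ext fun z => ?_)
  -- the derivative of the change of charts is surjective
  obtain ⟨y, hy⟩ : ∃ y, fderiv ℝ (coordMap (m := n) (n := n) id p (γ t))
      (extChartAt (𝓡 n) p (γ t)) y = z := by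
    refine ⟨toCoord p (γ t) z, ?_⟩
    have := fderiv_coordMap_toCoord hid hp hq z
    rw [mfderiv_id] at this
    rw [this]
    exact toCoord_self (γ t) z
  rw [← hy]
  exact (horth y).trans (DFunLike.congr_fun (map_zero (h.inChart (γ t) _)) _).symm

end LorentzianMetric

end CoordinateExpression

/-! ### The second fundamental form -/

section SecondFundamentalForm

variable {m n : ℕ} {M : Type*} [TopologicalSpace M]
  [ChartedSpace (EuclideanSpace ℝ (Fin m)) M] [IsManifold (𝓡 m) ∞ M]
  {S : Type*} [TopologicalSpace S] [ChartedSpace (EuclideanSpace ℝ (Fin n)) S]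
  [IsManifold (𝓡 n) ∞ S] {f : S → M}

/-- The vector field with constant components `v` in the preferred chart at `p` does have
components `v` at all points of the chart domain. -/
theorem toCoord_mpullback_const (p : S) (v : EuclideanSpace ℝ (Fin n)) {x : S}
    (hx : x ∈ (extChartAt (𝓡 n) p).source) :
    toCoord p x (mpullback (𝓡 n) 𝓘(ℝ, EuclideanSpace ℝ (Fin n)) (extChartAt (𝓡 n) p)
      (fun _ => v) x) = v := by
  have : IsManifold (𝓡 n) 1 S := isManifold_one
  exact (isInvertible_mfderiv_extChartAt hx).self_apply_inverse v

theorem mfderiv_eq_fderiv_coordMap (hf : ContMDiff (𝓡 n) (𝓡 m) ∞ f) (p : S)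
    (v : TangentSpace (𝓡 n) p) :
    fderiv ℝ (coordMap (m := m) f p (f p)) (extChartAt (𝓡 n) p p) v =
      mfderiv (𝓡 n) (𝓡 m) f p v := by
  have h := fderiv_coordMap_toCoord hf (mem_extChartAt_source (I := 𝓡 n) p)
    (mem_extChartAt_source (I := 𝓡 m) (f p)) v
  rwa [toCoord_self, toCoord_self] at h

namespace LorentzianMetric

variable (g : LorentzianMetric m M) (h : LorentzianMetric n S)

/-- The second fundamental form in the preferred charts at `p` and `f p`. -/
theorem secondFundamentalForm_eq (hf : ContMDiff (𝓡 n) (𝓡 m) ∞ f) (p : S)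
    (v w : TangentSpace (𝓡 n) p) :
    secondFundamentalForm g h f p v w =
      (fderiv ℝ (fderiv ℝ (coordMap (m := m) f p (f p))) (extChartAt (𝓡 n) p p) w v
        + christoffel (g.inChart (f p)) (coordMap f p (f p) (extChartAt (𝓡 n) p p))
          (fderiv ℝ (coordMap f p (f p)) (extChartAt (𝓡 n) p p) w)
          (fderiv ℝ (coordMap f p (f p)) (extChartAt (𝓡 n) p p) v)
        - fderiv ℝ (coordMap f p (f p)) (extChartAt (𝓡 n) p p)
          (christoffel (h.inChart p) (extChartAt (𝓡 n) p p) w v) :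
        EuclideanSpace ℝ (Fin m)) := by
  have : IsManifold (𝓡 n) 1 S := isManifold_one
  set X : ∀ x : S, TangentSpace (𝓡 n) x :=
    mpullback (𝓡 n) 𝓘(ℝ, EuclideanSpace ℝ (Fin n)) (extChartAt (𝓡 n) p) fun _ => v with hX
  have hp := mem_extChartAt_source (I := 𝓡 n) p
  have hfp := mem_extChartAt_source (I := 𝓡 m) (f p)
  have hXc : ∀ {x : S}, x ∈ (extChartAt (𝓡 n) p).source → toCoord p x (X x) = v := fun hx =>
    toCoord_mpullback_const p v hx
  have hXp : X p = v := (toCoord_self p (X p)).symm.trans (hXc hp)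
  have hsrc := (isOpen_extChartAt_source (I := 𝓡 n) p).mem_nhds hp
  -- the components of `X` are constant
  have hlc : h.leviCivita X p w =
      (christoffel (h.inChart p) (extChartAt (𝓡 n) p p) w v : EuclideanSpace ℝ (Fin n)) := by
    have hev : (fun x => toCoord p x (X x)) =ᶠ[nhds p] fun _ => v :=
      Filter.mem_of_superset hsrc fun x hx => hXc hx
    have h1 : mfderiv (𝓡 n) 𝓘(ℝ, EuclideanSpace ℝ (Fin n)) (fun x => toCoord p x (X x)) p w
        = (0 : EuclideanSpace ℝ (Fin n)) := by
      rw [hev.mfderiv_eq]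
      erw [mfderiv_const]
      rfl
    have h2 : mfderiv (𝓡 n) (𝓡 n) (fun y : S => y) p w = w :=
      DFunLike.congr_fun (mfderiv_id (I := 𝓡 n) (x := p)) w
    unfold leviCivita covDerivAlong
    rw [h1, h2, hXp]
    exact zero_add _
  -- the components of `df X` are given by the derivative of the coordinate expression of `f`
  have hF := contDiffAt_coordMap hf hp hfp
  have hcov : g.covDerivAlong (𝓡 n) f (fun x => mfderiv (𝓡 n) (𝓡 m) f x (X x)) p w =
      (fderiv ℝ (fderiv ℝ (coordMap (m := m) f p (f p))) (extChartAt (𝓡 n) p p) w v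
        + christoffel (g.inChart (f p)) (extChartAt (𝓡 m) (f p) (f p))
          (mfderiv (𝓡 n) (𝓡 m) f p w) (mfderiv (𝓡 n) (𝓡 m) f p v) :
        EuclideanSpace ℝ (Fin m)) := by
    have hev : (fun x => toCoord (f p) (f x) (mfderiv (𝓡 n) (𝓡 m) f x (X x))) =ᶠ[nhds p]
        fun x => fderiv ℝ (coordMap (m := m) f p (f p)) (extChartAt (𝓡 n) p x) v := by
      filter_upwards [hsrc, hf.continuous.continuousAt.eventually_mem
        ((isOpen_extChartAt_source (I := 𝓡 m) (f p)).mem_nhds hfp)] with x hx hfx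
      rw [← fderiv_coordMap_toCoord hf hx hfx, hXc hx]
    have h1 : mfderiv (𝓡 n) 𝓘(ℝ, EuclideanSpace ℝ (Fin m))
        (fun x => toCoord (f p) (f x) (mfderiv (𝓡 n) (𝓡 m) f x (X x))) p w =
        fderiv ℝ (fderiv ℝ (coordMap (m := m) f p (f p))) (extChartAt (𝓡 n) p p) w v := by
      rw [hev.mfderiv_eq]
      have hd : DifferentiableAt ℝ
          (fun u => fderiv ℝ (coordMap (m := m) f p (f p)) u v) (extChartAt (𝓡 n) p p) :=
        ((hF.fderiv_right (m := 1) (by norm_cast)).clm_apply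
          contDiffAt_const).differentiableAt (by norm_num)
      have h2 := mfderiv_comp p (I' := 𝓘(ℝ, EuclideanSpace ℝ (Fin n)))
        (I'' := 𝓘(ℝ, EuclideanSpace ℝ (Fin m)))
        (g := fun u => fderiv ℝ (coordMap (m := m) f p (f p)) u v) hd.mdifferentiableAt
        (mdifferentiableAt_extChartAt (I := 𝓡 n) (x := p) (mem_chart_source _ p))
      have h3 := DFunLike.congr_fun h2 w
      refine h3.trans ?_
      have h4 : mfderiv (𝓡 n) 𝓘(ℝ, EuclideanSpace ℝ (Fin n)) (extChartAt (𝓡 n) p) p w = w :=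
        toCoord_self p w
      rw [mfderiv_eq_fderiv]
      have h5 : fderiv ℝ (fun u => fderiv ℝ (coordMap (m := m) f p (f p)) u v)
          (extChartAt (𝓡 n) p p) =
          (fderiv ℝ (fderiv ℝ (coordMap (m := m) f p (f p))) (extChartAt (𝓡 n) p p)).flip v :=
        fderiv_clm_apply_const ((hF.fderiv_right (m := 1) (by norm_cast)).differentiableAt
          (by norm_num)) _
      rw [h5]
      exact congrArg (fun z => fderiv ℝ (fderiv ℝ (coordMap (m := m) f p (f p)))
        (extChartAt (𝓡 n) p p) z v) h4
    unfold covDerivAlong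
    rw [h1]
    beta_reduce
    rw [hXp]
  have hFp : coordMap (m := m) f p (f p) (extChartAt (𝓡 n) p p) =
      extChartAt (𝓡 m) (f p) (f p) := coordMap_extChartAt f (f p) hp
  unfold secondFundamentalForm
  rw [hcov, hlc, hFp]
  have e := mfderiv_eq_fderiv_coordMap hf p
  rw [← e w, ← e v]
  exact congrArg (fun z : EuclideanSpace ℝ (Fin m) => _ - z) (e _).symm

variable {g h}

theorem secondFundamentalForm_comm (hf : ContMDiff (𝓡 n) (𝓡 m) ∞ f) (p : S)
    (v w : TangentSpace (𝓡 n) p) :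
    secondFundamentalForm g h f p v w = secondFundamentalForm g h f p w v := by
  have hp := mem_extChartAt_source (I := 𝓡 n) p
  have hfp := mem_extChartAt_source (I := 𝓡 m) (f p)
  have hFp : coordMap (m := m) f p (f p) (extChartAt (𝓡 n) p p) =
      extChartAt (𝓡 m) (f p) (f p) := coordMap_extChartAt f (f p) hp
  have hF := contDiffAt_coordMap hf hp hfp
  have hsymm := hF.isSymmSndFDerivAt (by simp; norm_cast)
  rw [secondFundamentalForm_eq g h hf, secondFundamentalForm_eq g h hf, hFp]
  have e1 := hsymm w v
  have e2 := christoffel_comm ((g.contDiffAt_inChart (f p)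
    ((extChartAt (𝓡 m) (f p)).map_source hfp)).differentiableAt (by norm_num))
    (g.inChart_symm _) (fderiv ℝ (coordMap (m := m) f p (f p)) (extChartAt (𝓡 n) p p) w)
    (fderiv ℝ (coordMap (m := m) f p (f p)) (extChartAt (𝓡 n) p p) v)
  have e3 := christoffel_comm ((h.contDiffAt_inChart p
    ((extChartAt (𝓡 n) p).map_source hp)).differentiableAt (by norm_num)) (h.inChart_symm _) w v
  rw [e1, e2, e3]

theorem secondFundamentalForm_add_right (hf : ContMDiff (𝓡 n) (𝓡 m) ∞ f) (p : S)
    (v w w' : TangentSpace (𝓡 n) p) :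
    secondFundamentalForm g h f p v (w + w') =
      secondFundamentalForm g h f p v w + secondFundamentalForm g h f p v w' := by
  have key : ∀ (D : EuclideanSpace ℝ (Fin n) →L[ℝ] EuclideanSpace ℝ (Fin n) →L[ℝ]
      EuclideanSpace ℝ (Fin m)) (A : EuclideanSpace ℝ (Fin n) →L[ℝ] EuclideanSpace ℝ (Fin m))
      (x : EuclideanSpace ℝ (Fin m)) (y v w w' : EuclideanSpace ℝ (Fin n)),
      D (w + w') v + christoffel (g.inChart (f p)) x (A (w + w')) (A v)
        - A (christoffel (h.inChart p) y (w + w') v) =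
      (D w v + christoffel (g.inChart (f p)) x (A w) (A v) - A (christoffel (h.inChart p) y w v))
      + (D w' v + christoffel (g.inChart (f p)) x (A w') (A v)
        - A (christoffel (h.inChart p) y w' v)) := by
    intro D A x y v w w'
    simp only [map_add, add_apply, christoffel_add_left]
    abel
  simp only [secondFundamentalForm_eq g h hf]
  exact key _ _ _ _ _ _ _

theorem secondFundamentalForm_smul_right (hf : ContMDiff (𝓡 n) (𝓡 m) ∞ f) (p : S) (a : ℝ)
    (v w : TangentSpace (𝓡 n) p) :
    secondFundamentalForm g h f p v (a • w) = a • secondFundamentalForm g h f p v w := by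
  have key : ∀ (D : EuclideanSpace ℝ (Fin n) →L[ℝ] EuclideanSpace ℝ (Fin n) →L[ℝ]
      EuclideanSpace ℝ (Fin m)) (A : EuclideanSpace ℝ (Fin n) →L[ℝ] EuclideanSpace ℝ (Fin m))
      (x : EuclideanSpace ℝ (Fin m)) (y v w : EuclideanSpace ℝ (Fin n)),
      D (a • w) v + christoffel (g.inChart (f p)) x (A (a • w)) (A v)
        - A (christoffel (h.inChart p) y (a • w) v) =
      a • (D w v + christoffel (g.inChart (f p)) x (A w) (A v)
        - A (christoffel (h.inChart p) y w v)) := by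
    intro D A x y v w
    simp only [map_smul, smul_apply, christoffel_smul_left]
    module
  simp only [secondFundamentalForm_eq g h hf]
  exact key _ _ _ _ _ _

/-- The second fundamental form at `p` as a bilinear map. -/
noncomputable def secondFundamentalBilin (g : LorentzianMetric m M) (h : LorentzianMetric n S)
    (hf : ContMDiff (𝓡 n) (𝓡 m) ∞ f) (p : S) :
    TangentSpace (𝓡 n) p →ₗ[ℝ] TangentSpace (𝓡 n) p →ₗ[ℝ] TangentSpace (𝓡 m) (f p) :=
  LinearMap.mk₂ ℝ (secondFundamentalForm g h f p)
    (fun v v' w => by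
      simp only [secondFundamentalForm_comm hf p _ w, secondFundamentalForm_add_right hf])
    (fun a v w => by
      simp only [secondFundamentalForm_comm hf p _ w, secondFundamentalForm_smul_right hf])
    (secondFundamentalForm_add_right hf p)
    (fun a v w => secondFundamentalForm_smul_right hf p a v w)

/-- The second fundamental form takes values in the normal bundle. -/
theorem secondFundamentalForm_normal (hf : ContMDiff (𝓡 n) (𝓡 m) ∞ f)
    (hiso : ∀ (p : S) (v w : TangentSpace (𝓡 n) p),
      h.val p v w = g.val (f p) (mfderiv (𝓡 n) (𝓡 m) f p v) (mfderiv (𝓡 n) (𝓡 m) f p w))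
    (p : S) (v w z : TangentSpace (𝓡 n) p) :
    g.val (f p) (secondFundamentalForm g h f p v w) (mfderiv (𝓡 n) (𝓡 m) f p z) = 0 := by
  have hp := mem_extChartAt_source (I := 𝓡 n) p
  have hfp := mem_extChartAt_source (I := 𝓡 m) (f p)
  have hFp : coordMap (m := m) f p (f p) (extChartAt (𝓡 n) p p) =
      extChartAt (𝓡 m) (f p) (f p) := coordMap_extChartAt f (f p) hp
  have hF := contDiffAt_coordMap hf hp hfp
  have hu := (extChartAt (𝓡 n) p).map_source hp
  have hu' := (extChartAt (𝓡 m) (f p)).map_source hfp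
  rw [← hFp] at hu'
  have horth := christoffel_gauss_orthogonal (h.inChart_isInvertible p hu)
    (g.inChart_isInvertible (f p) hu') ((h.contDiffAt_inChart p hu).differentiableAt (by norm_num))
    ((g.contDiffAt_inChart (f p) hu').differentiableAt (by norm_num)) (g.inChart_symm _)
    (hF.of_le (by norm_cast)) (eventually_inChart_eq hf hiso hp hfp) v w z
  rw [← g.inChart_self, ← mfderiv_eq_fderiv_coordMap hf, secondFundamentalForm_eq g h hf, ← hFp]
  exact horth

/-- The Gauss formula along a curve: the acceleration in `M` of a curve of `S` is the sum of its
acceleration in `S` and of the second fundamental form on its velocity. -/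
theorem covDerivAlong_comp_velocity (hf : ContMDiff (𝓡 n) (𝓡 m) ∞ f) {γ : ℝ → S} {t : ℝ}
    (hγ : ContMDiffAt 𝓘(ℝ, ℝ) (𝓡 n) 2 γ t) :
    g.covDerivAlong 𝓘(ℝ, ℝ) (f ∘ γ) (velocity m (f ∘ γ)) t (1 : ℝ) =
      mfderiv (𝓡 n) (𝓡 m) f (γ t) (h.covDerivAlong 𝓘(ℝ, ℝ) γ (velocity n γ) t (1 : ℝ))
        + secondFundamentalForm g h f (γ t) (velocity n γ t) (velocity n γ t) := by
  have hp := mem_extChartAt_source (I := 𝓡 n) (γ t)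
  have hfp := mem_extChartAt_source (I := 𝓡 m) (f (γ t))
  have hFp : coordMap (m := m) f (γ t) (f (γ t)) (extChartAt (𝓡 n) (γ t) (γ t)) =
      extChartAt (𝓡 m) (f (γ t)) (f (γ t)) := coordMap_extChartAt f (f (γ t)) hp
  have hF2 : ContDiffAt ℝ 2 (coordMap (m := m) f (γ t) (f (γ t)))
      (extChartAt (𝓡 n) (γ t) (γ t)) := (contDiffAt_coordMap hf hp hfp).of_le (by norm_cast)
  have hfγ : ContMDiffAt 𝓘(ℝ, ℝ) (𝓡 m) 2 (f ∘ γ) t :=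
    (hf.of_le (by norm_cast)).contMDiffAt.comp t hγ
  have hev : (fun s => extChartAt (𝓡 m) (f (γ t)) (f (γ s))) =ᶠ[nhds t]
      fun s => coordMap (m := m) f (γ t) (f (γ t)) (extChartAt (𝓡 n) (γ t) (γ s)) :=
    (eventually_mem_extChartAt_source hγ.continuousAt hp).mono fun s hs =>
      (coordMap_extChartAt f (f (γ t)) hs).symm
  obtain ⟨e1, e2⟩ := deriv_deriv_comp hF2 (contDiffAt_extChartAt_comp (by norm_cast) hγ hp)
  have hvel : deriv (fun s => extChartAt (𝓡 n) (γ t) (γ s)) t = velocity n γ t := by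
    rw [← toCoord_self (γ t) (velocity n γ t)]
    exact (hasDerivAt_extChartAt_comp (hγ.mdifferentiableAt (by norm_num)) hp).deriv
  have hM := covDerivAlong_velocity g hfγ
  simp only [Function.comp_apply] at hM
  rw [hev.deriv.deriv_eq, hev.deriv_eq, e1, e2, ← hFp] at hM
  have hS := covDerivAlong_velocity h hγ
  rw [secondFundamentalForm_eq g h hf, ← mfderiv_eq_fderiv_coordMap hf, hS, ← hvel]
  refine hM.trans ?_
  have key : ∀ (A : EuclideanSpace ℝ (Fin n) →L[ℝ] EuclideanSpace ℝ (Fin m))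
      (a b : EuclideanSpace ℝ (Fin m)) (x y : EuclideanSpace ℝ (Fin n)),
      a + A x + b = A (x + y) + (a + b - A y) := by
    intro A a b x y
    rw [map_add]
    abel
  exact key _ _ _ _ _

end LorentzianMetric

end SecondFundamentalForm

/-! ### Geodesics and conserved quantities -/

section Geodesics

variable {m n : ℕ} {M : Type*} [TopologicalSpace M]
  [ChartedSpace (EuclideanSpace ℝ (Fin m)) M] [IsManifold (𝓡 m) ∞ M]
  {S : Type*} [TopologicalSpace S] [ChartedSpace (EuclideanSpace ℝ (Fin n)) S]
  [IsManifold (𝓡 n) ∞ S] {f : S → M}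

omit [IsManifold (𝓡 m) ∞ M] [IsManifold (𝓡 n) ∞ S] in
theorem velocity_comp {γ : ℝ → S} {t : ℝ} (hf : ContMDiff (𝓡 n) (𝓡 m) ∞ f)
    (hγ : MDifferentiableAt 𝓘(ℝ, ℝ) (𝓡 n) γ t) :
    velocity m (f ∘ γ) t = mfderiv (𝓡 n) (𝓡 m) f (γ t) (velocity n γ t) :=
  DFunLike.congr_fun (mfderiv_comp t (hf.mdifferentiableAt (by norm_num)) hγ) (1 : ℝ)

theorem mdifferentiableAt_toCoord {K : ∀ x : M, TangentSpace (𝓡 m) x}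
    (hK : ContMDiff (𝓡 m) (𝓡 m).tangent ∞ fun x => (⟨x, K x⟩ : TangentBundle (𝓡 m) M)) (q : M) :
    MDifferentiableAt (𝓡 m) 𝓘(ℝ, EuclideanSpace ℝ (Fin m)) (fun y => toCoord q y (K y)) q := by
  have : IsManifold (𝓡 m) 1 M := isManifold_one
  have h := (contMDiffAt_section (F := EuclideanSpace ℝ (Fin m))
    (E := (TangentSpace (𝓡 m) : M → Type)) (s := K) q).1 (hK q)
  refine (h.mdifferentiableAt (by norm_num)).congr_of_eventuallyEq ?_
  filter_upwards [(chartAt (EuclideanSpace ℝ (Fin m)) q).open_source.mem_nhds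
    (mem_chart_source _ q)] with y hy
  rw [toCoord, ← TangentBundle.continuousLinearMapAt_trivializationAt hy,
    Trivialization.continuousLinearMapAt_apply, Trivialization.linearMapAt_apply, if_pos]
  simpa using hy

namespace LorentzianMetric

/-- The covariant derivative along a curve of the restriction of a vector field on `M`. -/
theorem covDerivAlong_comp_eq_leviCivita (g : LorentzianMetric m M)
    {K : ∀ x : M, TangentSpace (𝓡 m) x}
    (hK : ContMDiff (𝓡 m) (𝓡 m).tangent ∞ fun x => (⟨x, K x⟩ : TangentBundle (𝓡 m) M))
    {c : ℝ → M} {t : ℝ} (hc : MDifferentiableAt 𝓘(ℝ, ℝ) (𝓡 m) c t) :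
    DifferentiableAt ℝ (fun s => toCoord (c t) (c s) (K (c s))) t ∧
    g.covDerivAlong 𝓘(ℝ, ℝ) c (fun s => K (c s)) t (1 : ℝ) =
      g.leviCivita K (c t) (velocity m c t) := by
  have hd := mdifferentiableAt_toCoord hK (c t)
  refine ⟨(hd.comp t hc).differentiableAt, ?_⟩
  have h1 := DFunLike.congr_fun (mfderiv_comp t hd hc) (1 : ℝ)
  have h2 : mfderiv (𝓡 m) (𝓡 m) (fun y : M => y) (c t) (velocity m c t) = velocity m c t :=
    DFunLike.congr_fun (mfderiv_id (I := 𝓡 m) (x := c t)) _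
  unfold leviCivita covDerivAlong
  rw [h2]
  exact congrArg (fun z : EuclideanSpace ℝ (Fin m) => z + christoffel (g.inChart (c t))
    (extChartAt (𝓡 m) (c t) (c t)) (velocity m c t) (K (c t))) h1

/-- Local existence of geodesics with prescribed initial velocity `v`. As `v` lives in the tangent space
at `p` and the velocity in the one at `γ 0`, their equality is stated in the model space. -/
theorem exists_geodesic (h : LorentzianMetric n S) (p : S) (v : TangentSpace (𝓡 n) p) :
    ∃ γ : ℝ → S, ∃ ε > (0 : ℝ), γ 0 = p ∧
      (velocity n γ 0 : EuclideanSpace ℝ (Fin n)) = (v : EuclideanSpace ℝ (Fin n)) ∧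
      ∀ t ∈ Set.Ioo (-ε) ε, ContMDiffAt 𝓘(ℝ, ℝ) (𝓡 n) 2 γ t ∧
        h.covDerivAlong 𝓘(ℝ, ℝ) γ (velocity n γ) t (1 : ℝ) = 0 := by
  have hp := mem_extChartAt_source (I := 𝓡 n) p
  have hu := (extChartAt (𝓡 n) p).map_source hp
  obtain ⟨c, c', hc0, hc0', ε₀, hε₀, hc⟩ :=
    exists_coordinate_geodesic (h.inChart_isInvertible p hu) (h.contDiffAt_inChart p hu) v
  -- shrink the interval so that the solution stays in the chart
  have hcont0 : ContinuousAt c 0 := (hc 0 ⟨by linarith, hε₀⟩).1.continuousAt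
  have htarget : ∀ᶠ t in nhds (0 : ℝ), c t ∈ (extChartAt (𝓡 n) p).target :=
    hcont0.eventually_mem ((isOpen_extChartAt_target p).mem_nhds (by rwa [hc0]))
  obtain ⟨δ, hδ, hδc⟩ := Metric.eventually_nhds_iff.1 htarget
  set ε := min ε₀ δ with hε
  have hmem : ∀ t ∈ Set.Ioo (-ε) ε, c t ∈ (extChartAt (𝓡 n) p).target := fun t ht => by
    apply hδc
    rw [Real.dist_eq, sub_zero, abs_lt]
    exact ⟨by linarith [ht.1, min_le_right ε₀ δ], by linarith [ht.2, min_le_right ε₀ δ]⟩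
  have hsol : ∀ t ∈ Set.Ioo (-ε) ε, HasDerivAt c (c' t) t ∧
      HasDerivAt c' (-christoffel (h.inChart p) (c t) (c' t) (c' t)) t := fun t ht =>
    hc t ⟨by linarith [ht.1, min_le_left ε₀ δ], by linarith [ht.2, min_le_left ε₀ δ]⟩
  have hopen : IsOpen (Set.Ioo (-ε) ε) := isOpen_Ioo
  have hc'C : ContDiffOn ℝ 1 c' (Set.Ioo (-ε) ε) := by
    rw [show (1 : WithTop ℕ∞) = 0 + 1 from (zero_add 1).symm,
      contDiffOn_succ_iff_deriv_of_isOpen hopen]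
    refine ⟨fun t ht => (hsol t ht).2.differentiableAt.differentiableWithinAt, by simp, ?_⟩
    rw [contDiffOn_zero]
    refine ContinuousOn.congr (f := fun t => -christoffel (h.inChart p) (c t) (c' t) (c' t)) ?_
      fun t ht => (hsol t ht).2.deriv
    intro t ht
    refine (ContinuousAt.neg ?_).continuousWithinAt
    exact ContinuousAt.comp
      (g := fun x : EuclideanSpace ℝ (Fin n) × EuclideanSpace ℝ (Fin n) ×
        EuclideanSpace ℝ (Fin n) => christoffel (h.inChart p) x.1 x.2.1 x.2.2)
      (f := fun t => (c t, c' t, c' t))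
      (contDiffAt_christoffel (h.inChart_isInvertible p (hmem t ht))
        (h.contDiffAt_inChart p (hmem t ht)) (c' t) (c' t)).continuousAt
      ((hsol t ht).1.continuousAt.prodMk ((hsol t ht).2.continuousAt.prodMk
        (hsol t ht).2.continuousAt))
  have hcC : ContDiffOn ℝ 2 c (Set.Ioo (-ε) ε) := by
    rw [show (2 : WithTop ℕ∞) = 1 + 1 from one_add_one_eq_two.symm,
      contDiffOn_succ_iff_deriv_of_isOpen hopen]
    exact ⟨fun t ht => (hsol t ht).1.differentiableAt.differentiableWithinAt, by simp,
      hc'C.congr fun t ht => (hsol t ht).1.deriv⟩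
  set γ : ℝ → S := fun t => (extChartAt (𝓡 n) p).symm (c t) with hγ
  have hγC : ∀ t ∈ Set.Ioo (-ε) ε, ContMDiffAt 𝓘(ℝ, ℝ) (𝓡 n) 2 γ t := fun t ht =>
    (((contMDiffOn_extChartAt_symm (n := ∞) p).contMDiffAt
      ((isOpen_extChartAt_target p).mem_nhds (hmem t ht))).of_le (by norm_cast)).comp t
      (hcC.contDiffAt (hopen.mem_nhds ht)).contMDiffAt
  have hcoord : ∀ t ∈ Set.Ioo (-ε) ε, extChartAt (𝓡 n) p (γ t) = c t := fun t ht =>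
    (extChartAt (𝓡 n) p).right_inv (hmem t ht)
  have hsrc : ∀ t ∈ Set.Ioo (-ε) ε, γ t ∈ (extChartAt (𝓡 n) p).source := fun t ht =>
    (extChartAt (𝓡 n) p).map_target (hmem t ht)
  have hεpos : 0 < ε := lt_min hε₀ hδ
  have h0 : (0 : ℝ) ∈ Set.Ioo (-ε) ε := ⟨by linarith, hεpos⟩
  have hevc : ∀ t ∈ Set.Ioo (-ε) ε, (fun s => extChartAt (𝓡 n) p (γ s)) =ᶠ[nhds t] c :=
    fun t ht => Filter.mem_of_superset (hopen.mem_nhds ht) hcoord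
  have hderiv : ∀ t ∈ Set.Ioo (-ε) ε, deriv (fun s => extChartAt (𝓡 n) p (γ s)) t = c' t :=
    fun t ht => (hevc t ht).deriv_eq.trans (hsol t ht).1.deriv
  have hγ0 : γ 0 = p := by
    rw [hγ]
    simp only [hc0]
    exact (extChartAt (𝓡 n) p).left_inv hp
  refine ⟨γ, ε, hεpos, hγ0, ?_, fun t ht => ⟨hγC t ht, ?_⟩⟩
  · have h1 := (hasDerivAt_extChartAt_comp ((hγC 0 h0).mdifferentiableAt (by norm_num))
      (hsrc 0 h0)).deriv
    rw [hderiv 0 h0, hc0'] at h1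
    have h2 : ∀ (x : S) (_ : x = p) (w : TangentSpace (𝓡 n) x),
        toCoord p x w = (w : EuclideanSpace ℝ (Fin n)) := by
      rintro _ rfl w
      exact toCoord_self _ w
    exact (h2 _ hγ0 _).symm.trans h1.symm
  · refine covDerivAlong_velocity_eq_zero (hγC t ht) (hsrc t ht) ?_
    have hdd : (deriv fun s => extChartAt (𝓡 n) p (γ s)) =ᶠ[nhds t] c' :=
      Filter.mem_of_superset (hopen.mem_nhds ht) hderiv
    rw [hdd.deriv_eq, hderiv t ht, (hsol t ht).2.deriv, hcoord t ht]
    exact neg_add_cancel _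

/-- The derivative of `⟨γ', γ'⟩` vanishes where `∇_γ' γ' = 0`. -/
theorem hasDerivAt_val_velocity_self (h : LorentzianMetric n S) {γ : ℝ → S} {t : ℝ}
    (hγ : ContMDiffAt 𝓘(ℝ, ℝ) (𝓡 n) 2 γ t)
    (hgeo : h.covDerivAlong 𝓘(ℝ, ℝ) γ (velocity n γ) t (1 : ℝ) = 0) :
    HasDerivAt (fun s => h.val (γ s) (velocity n γ s) (velocity n γ s)) 0 t := by
  have hd := differentiableAt_toCoord_velocity hγ (mem_extChartAt_source (I := 𝓡 n) (γ t))
  have := h.hasDerivAt_val (hγ.mdifferentiableAt (by norm_num)) hd hd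
  rw [hgeo] at this
  simpa using this

/-- Along a geodesic of an isometrically embedded `S`, the scalar product of the velocity with a
Killing field of `M` that is tangent to `S` is constant: the acceleration in `M` is normal to `S`. -/
theorem hasDerivAt_val_killing {g : LorentzianMetric m M} {h : LorentzianMetric n S}
    (hf : ContMDiff (𝓡 n) (𝓡 m) ∞ f)
    (hiso : ∀ (p : S) (v w : TangentSpace (𝓡 n) p),
      h.val p v w = g.val (f p) (mfderiv (𝓡 n) (𝓡 m) f p v) (mfderiv (𝓡 n) (𝓡 m) f p w))
    {K : ∀ x : M, TangentSpace (𝓡 m) x} (hK : g.IsKilling K)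
    (htan : ∀ p : S, K (f p) ∈ Set.range (mfderiv (𝓡 n) (𝓡 m) f p))
    {γ : ℝ → S} {t : ℝ} (hγ : ContMDiffAt 𝓘(ℝ, ℝ) (𝓡 n) 2 γ t)
    (hgeo : h.covDerivAlong 𝓘(ℝ, ℝ) γ (velocity n γ) t (1 : ℝ) = 0) :
    HasDerivAt (fun s => g.val (f (γ s)) (K (f (γ s))) (velocity m (f ∘ γ) s)) 0 t := by
  have hfγ : ContMDiffAt 𝓘(ℝ, ℝ) (𝓡 m) 2 (f ∘ γ) t :=
    (hf.of_le (by norm_cast)).contMDiffAt.comp t hγ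
  have hmd : MDifferentiableAt 𝓘(ℝ, ℝ) (𝓡 m) (f ∘ γ) t := hfγ.mdifferentiableAt (by norm_num)
  obtain ⟨hdK, hcov⟩ := g.covDerivAlong_comp_eq_leviCivita hK.smooth hmd
  have hmain := g.hasDerivAt_val hmd hdK
    (differentiableAt_toCoord_velocity hfγ (mem_extChartAt_source (I := 𝓡 m) ((f ∘ γ) t)))
  refine hmain.congr_deriv ?_
  have hkill : g.val ((f ∘ γ) t) (g.covDerivAlong 𝓘(ℝ, ℝ) (f ∘ γ) (fun s => K ((f ∘ γ) s)) t
      (1 : ℝ)) (velocity m (f ∘ γ) t) = 0 := by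
    rw [hcov]
    have := hK.killing ((f ∘ γ) t) (velocity m (f ∘ γ) t) (velocity m (f ∘ γ) t)
    rw [g.symm _ (velocity m (f ∘ γ) t)] at this
    linarith
  have hacc : g.val ((f ∘ γ) t) (K ((f ∘ γ) t))
      (g.covDerivAlong 𝓘(ℝ, ℝ) (f ∘ γ) (velocity m (f ∘ γ)) t (1 : ℝ)) = 0 := by
    rw [covDerivAlong_comp_velocity (h := h) hf hγ, hgeo, map_zero, zero_add]
    obtain ⟨z, hz⟩ := htan (γ t)
    rw [g.symm, Function.comp_apply, ← hz]
    exact secondFundamentalForm_normal hf hiso (γ t) _ _ z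
  rw [hkill, hacc, add_zero]

end LorentzianMetric

end Geodesics

/-! ### Null geodesics with given impact parameter -/

theorem proposition3 {m n : ℕ}
    {M : Type*} [TopologicalSpace M] [T2Space M] [SecondCountableTopology M]
    [ChartedSpace (EuclideanSpace ℝ (Fin m)) M] [IsManifold (𝓡 m) ∞ M]
    {S : Type*} [TopologicalSpace S]
    [ChartedSpace (EuclideanSpace ℝ (Fin n)) S] [IsManifold (𝓡 n) ∞ S]
    (g : LorentzianMetric m M) (h : LorentzianMetric n S)
    (K : Fin 2 → ∀ x : M, TangentSpace (𝓡 m) x) (hK : g.IsKillingPair K)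
    (f : S → M) (hf : LorentzianMetric.IsIsometricEmbedding h g f)
    (hinv : IsInvariantSubmanifold (n := n) K f)
    (ρ : ℝ) (hO : Set.range f ⊆ g.accessibleRegion K ρ) :
    (∀ (γ : ℝ → S) (J : Set ℝ), h.IsNullGeodesicOn γ J →
        g.HasImpactParameterOn K ρ (f ∘ γ) J → g.IsNullGeodesicOn (f ∘ γ) J) ↔
      LorentzianMetric.IsTotallyUmbilic g h f (g.rhoPerp K ρ f) := by
  have hsm : ContMDiff (𝓡 n) (𝓡 m) ∞ f := hf.isSmoothEmbedding.contMDiff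
  have hiso := hf.isometric
  have hmemV : ∀ (p : S) (v : TangentSpace (𝓡 n) p), v ∈ g.rhoPerp K ρ f p ↔
      g.val (f p) (rhoHat K ρ (f p)) (mfderiv (𝓡 n) (𝓡 m) f p v) = 0 := fun p v => Iff.rfl
  have hsplit : ∀ (x : M) (w : TangentSpace (𝓡 m) x), g.val x (rhoHat K ρ x) w =
      ρ * g.val x (K 0 x) w + g.val x (K 1 x) w := fun x w => by
    simp [rhoHat]
  constructor
  · intro hi p
    obtain ⟨a, ha⟩ := (hinv p).1 0
    obtain ⟨b, hb⟩ := (hinv p).1 1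
    have hsymm := h.symm p
    have hr : mfderiv (𝓡 n) (𝓡 m) f p (ρ • a + b) = rhoHat K ρ (f p) := by
      rw [map_add, map_smul, ha, hb, rhoHat]
    have hrr : 0 < h.val p (ρ • a + b) (ρ • a + b) := by
      rw [hiso, hr]
      exact hO ⟨p, rfl⟩
    have hdet : h.val p a a * h.val p (ρ • a + b) (ρ • a + b)
        - h.val p a (ρ • a + b) * h.val p a (ρ • a + b) < 0 := by
      have hd := hK.det_neg (f p)
      rw [Matrix.det_fin_two] at hd
      simp only [LorentzianMetric.gram, Matrix.of_apply] at hd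
      rw [← ha, ← hb, ← hiso, ← hiso, ← hiso, ← hiso, hsymm b a] at hd
      have e : h.val p a a * h.val p (ρ • a + b) (ρ • a + b)
          - h.val p a (ρ • a + b) * h.val p a (ρ • a + b) =
          h.val p a a * h.val p b b - h.val p a b * h.val p a b := by
        simp [hsymm b a]
        ring
      rwa [e]
    obtain ⟨x, y, hu, hbu⟩ := exists_timelike_orthogonal hsymm hdet hrr
    set u := x • a + y • (ρ • a + b) with hudef
    have hVh : ∀ v, v ∈ g.rhoPerp K ρ f p ↔ h.val p (ρ • a + b) v = 0 := fun v => by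
      rw [hmemV, hiso, hr]
    have hnull : ∀ v ∈ g.rhoPerp K ρ f p, h.val p v v = 0 →
        LorentzianMetric.secondFundamentalBilin g h hsm p v v = 0 := by
      intro v hv hvv
      by_cases hv0 : v = 0
      · simp [hv0]
      -- a null vector orthogonal to `ρ̂` is not orthogonal to `K_t`
      have hav : h.val p a v ≠ 0 := fun hav => by
        have huv : h.val p u v = 0 := by
          rw [hudef, map_add, map_smul, map_smul, add_apply, smul_apply, smul_apply, hav,
            (hVh v).1 hv]
          simp
        have := (h.lorentzian p).pos_of_orthogonal hsymm hu huv hv0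
        rw [hvv] at this
        exact lt_irrefl _ this
      obtain ⟨γ, ε, hε, hγ0, hγv, hγ⟩ := h.exists_geodesic p v
      subst hγ0
      obtain rfl : velocity n γ 0 = v := hγv
      have h0 : (0 : ℝ) ∈ Set.Ioo (-ε) ε := ⟨by linarith, hε⟩
      have hconst : ∀ E : ℝ → ℝ, (∀ t ∈ Set.Ioo (-ε) ε, HasDerivAt E 0 t) →
          ∀ t ∈ Set.Ioo (-ε) ε, E t = E 0 := fun E hE t ht =>
        isOpen_Ioo.is_const_of_deriv_eq_zero isPreconnected_Ioo
          (fun s hs => (hE s hs).differentiableAt.differentiableWithinAt)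
          (fun s hs => (hE s hs).deriv) ht h0
      have hmd : ∀ t ∈ Set.Ioo (-ε) ε, MDifferentiableAt 𝓘(ℝ, ℝ) (𝓡 n) γ t := fun t ht =>
        (hγ t ht).1.mdifferentiableAt (by norm_num)
      have hE : ∀ α, ∀ t ∈ Set.Ioo (-ε) ε,
          g.val (f (γ t)) (K α (f (γ t))) (velocity m (f ∘ γ) t) =
            g.val (f (γ 0)) (K α (f (γ 0))) (velocity m (f ∘ γ) 0) := fun α =>
        hconst (fun t => g.val (f (γ t)) (K α (f (γ t))) (velocity m (f ∘ γ) t)) fun t ht =>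
          LorentzianMetric.hasDerivAt_val_killing hsm hiso (hK.killing α)
            (fun p => (hinv p).1 α) (hγ t ht).1 (hγ t ht).2
      have hE0 : g.val (f (γ 0)) (K 0 (f (γ 0))) (velocity m (f ∘ γ) 0) ≠ 0 := by
        have e := velocity_comp hsm (hmd 0 h0)
        rw [e, ← ha]
        rwa [hiso] at hav
      -- the velocity cannot vanish, because the energy is a nonzero constant
      have hgeo : h.IsNullGeodesicOn γ (Set.Ioo (-ε) ε) :=
        { isOpen := isOpen_Ioo
          ordConnected := Set.ordConnected_Ioo
          contMDiffOn := fun t ht => (hγ t ht).1.contMDiffWithinAt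
          geodesic := fun t ht => (hγ t ht).2
          velocity_ne_zero := fun t ht hvel => by
            have e := velocity_comp hsm (hmd t ht)
            have h1 := hE 0 t ht
            rw [e, hvel, map_zero, map_zero] at h1
            exact hE0 h1.symm
          null := fun t ht => (hconst _ (fun s hs =>
            h.hasDerivAt_val_velocity_self (hγ s hs).1 (hγ s hs).2) t ht).trans hvv }
      have himp : g.HasImpactParameterOn K ρ (f ∘ γ) (Set.Ioo (-ε) ε) := fun t ht => by
        have h1 := hE 0 t ht
        have h2 := hE 1 t ht
        have h3 := (hmemV _ _).1 hv
        rw [← velocity_comp hsm (hmd 0 h0), hsplit] at h3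
        simp only [Function.comp_apply]
        rw [h1, h2]
        refine ⟨hE0, ?_⟩
        rw [eq_div_iff hE0]
        linarith
      have hM := (hi γ _ hgeo himp).geodesic 0 h0
      rw [LorentzianMetric.covDerivAlong_comp_velocity (h := h) hsm (hγ 0 h0).1, (hγ 0 h0).2,
        map_zero, zero_add] at hM
      exact hM
    refine ⟨(h.val p u u)⁻¹ • LorentzianMetric.secondFundamentalBilin g h hsm p u u, fun z => ?_,
      fun v hv w hw => ?_⟩
    · rw [map_smul, smul_apply]
      have : g.val (f p) (LorentzianMetric.secondFundamentalBilin g h hsm p u u)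
        (mfderiv (𝓡 n) (𝓡 m) f p z) = 0 :=
          LorentzianMetric.secondFundamentalForm_normal hsm hiso p u u z
      rw [this, smul_zero]
    · exact exists_eq_smul_of_null (h.lorentzian p) hsymm (g.rhoPerp K ρ f p) ((hVh u).2 hbu) hu
        (LorentzianMetric.secondFundamentalBilin g h hsm p)
        (LorentzianMetric.secondFundamentalForm_comm hsm p) hnull hv hw
  · intro humb γ J hγ himp
    have hC : ∀ t ∈ J, ContMDiffAt 𝓘(ℝ, ℝ) (𝓡 n) 2 γ t := fun t ht =>
      hγ.contMDiffOn.contMDiffAt (hγ.isOpen.mem_nhds ht)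
    have hvel : ∀ t ∈ J, velocity m (f ∘ γ) t =
        mfderiv (𝓡 n) (𝓡 m) f (γ t) (velocity n γ t) := fun t ht =>
      velocity_comp hsm ((hC t ht).mdifferentiableAt (by norm_num))
    refine ⟨hγ.isOpen, hγ.ordConnected, (hsm.of_le (by norm_cast)).comp_contMDiffOn hγ.contMDiffOn,
      fun t ht => ?_, fun t ht hz => ?_, fun t ht => ?_⟩
    · obtain ⟨H, -, hH⟩ := humb (γ t)
      obtain ⟨h1, h2⟩ := himp t ht
      have hV : velocity n γ t ∈ g.rhoPerp K ρ f (γ t) := by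
        rw [hmemV, ← hvel t ht, hsplit]
        rw [eq_div_iff h1] at h2
        simp only [Function.comp_apply] at h2
        linarith
      rw [LorentzianMetric.covDerivAlong_comp_velocity (h := h) hsm (hC t ht), hγ.geodesic t ht,
        map_zero, zero_add, hH _ hV _ hV, hγ.null t ht, zero_smul]
    -- the isometric map `f` has injective derivative
    · refine hγ.velocity_ne_zero t ht (h.nondegenerate _ _ fun w => ?_)
      rw [hiso, ← hvel t ht, hz, map_zero]
      rfl
    · rw [hvel t ht]
      exact (hiso _ _ _).symm.trans (hγ.null t ht)
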